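/- **Setting.** Let $\mathcal M$ be a non-empty compact metric space of models (with its Borel $\sigma$-algebra), $\Pi$ a non-empty finite decision space and $\mathcal O$ a measurable observation space. Each model $M$ assigns to each decision $\pi$ a law $M(\pi)$ on $\mathcal O$ (measurably in $M$) and a mean reward $f_M(\pi)\in\mathbb R$, where $f$ is bounded and measurable in $M$. A belief is a probability measure $\nu$ on $\mathcal M\times\Pi$, the law of a pair $(M,\pi^*)$. Its predictive law under decision $\pi$ is $\nu_{o|\pi}=\int M(\pi)\,d\nu$, and $\nu_{\pi^*|\pi,o}$ is the marginal Bayesian posterior of $\pi^*$ given that decision $\pi$ produced observation $o\sim M(\pi)$; it is determined for $\nu_{o|\pi}$-almost every $o$. For $\eta>0$, $p\in\Delta(\Pi)$ and $q\in\mathrm{int}(\Delta(\Pi))$ let $$\mathrm{AIR}_{q,\eta}(p,\nu)=\mathbb E\Big[f_M(\pi^*)-f_M(\pi)-\tfrac1\eta\mathrm{KL}(\nu_{\pi^*|\pi,o},q)\Big],\qquad \pi\sim p,\ (M,\pi^*)\sim\nu \text{ independent},\ o\sim M(\pi),$$ and for beliefs $\nu,\nu^*$ let $$\Big\langle \tfrac{\partial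 \mathrm{AIR}_{q,\eta}(p,\nu)}{\partial\nu},\nu^*-\nu\Big\rangle=\lim_{\varepsilon\downarrow0}\frac{\mathrm{AIR}_{q,\eta}(p,(1-\varepsilon)\nu+\varepsilon\nu^*)-\mathrm{AIR}_{q,\eta}(p,\nu)}{\varepsilon}\in(-\infty,+\infty]$$ (AIR is concave in $\nu$). **Game.** In rounds $t=1,\dots,T$ the algorithm computes $p_t\in\Delta(\Pi)$ from the past decisions and observations $(\pi_s,o_s)_{s<t}$, the environment selects a model $M_t\in\mathcal M$ in an arbitrary way (obliviously or adaptively, possibly at random), and, given the past decisions and observations and $M_t$, one draws $\pi_t\sim p_t$ and then $o_t\sim M_t(\pi_t)$. The regret is $$\mathrm{Reg}_T=\sup_{\bar\pi\in\Pi}\mathbb E\Big[\sum_{t=1}^T f_{M_t}(\bar\pi)-\sum_{t=1}^T f_{M_t}(\pi_t)\Big].$$ **Theorem 3.4.** Let $\eta>0$ and $T\in\mathbb N$, let $p_1,\dots,p_T$ be produced by an arbitrary algorithm, and let $\nu_1,\dots,\nu_T$ be arbitrary beliefs, $\nu_t$ being a measurable function of $(\pi_s,o_s)_{s<t}$. Let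 $q_1$ be uniform on $\Pi$ and $q_{t+1}=(\nu_t)_{\pi^*|\pi_t,o_t}$ for $1\le t<T$ (any jointly measurable version of the posteriors). Assume that almost surely $q_t\in\mathrm{int}(\Delta(\Pi))$ for all $t\le T$, and that for $t<T$ the posterior $(\nu_t)_{\pi^*|\pi_t,o_t}$ is determined at the actual observation, i.e. almost surely $M_t(\pi)\ll(\nu_t)_{o|\pi}$ for all $\pi$ with $p_t(\pi)>0$. Then $$\mathrm{Reg}_T\le\frac{\log|\Pi|}{\eta}+\mathbb E\left[\sum_{t=1}^T\left(\mathrm{AIR}_{q_t,\eta}(p_t,\nu_t)+\sup_{\nu^*}\Big\langle\left.\tfrac{\partial\mathrm{AIR}_{q_t,\eta}(p_t,\nu)}{\partial\nu}\right|_{\nu=\nu_t},\nu^*-\nu_t\Big\rangle\right)\right],$$ where the supremum is over all beliefs $\nu^*$ and the right-hand side may be $+\infty$. -/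

import Mathlib

open MeasureTheory ProbabilityTheory Filter Topology
open scoped ENNReal NNReal

noncomputable section

namespace AlgorithmicBeliefs

/-! `𝓜` is the model class, `A` the (finite) decision space, `𝒪` the observation space.  A model is
identified with its family of observation laws through a Markov kernel `obs`: `obs (M, a)` is the
law of the observation when decision `a` is taken in model `M`.  `f M a` is the mean reward.
A belief is a law `ν` of a pair `(M, a⋆)` in `𝓜 × A`. -/

section Beliefs

variable {𝓜 A 𝒪 : Type*} [MeasurableSpace 𝓜] [MeasurableSpace A] [MeasurableSpace 𝒪]

/-- The likelihood kernel of decision `a`: the law of the observation given `(M, a⋆)`, which is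
`obs (M, a)`. -/
def likelihood (obs : Kernel (𝓜 × A) 𝒪) (a : A) : Kernel (𝓜 × A) 𝒪 :=
  obs.comap (fun x => (x.1, a)) (measurable_fst.prodMk measurable_const)

instance (obs : Kernel (𝓜 × A) 𝒪) [IsMarkovKernel obs] (a : A) :
    IsMarkovKernel (likelihood obs a) := by
  unfold likelihood; infer_instance

/-- The predictive law of the observation under decision `a` and belief `ν`. -/
def predictive (obs : Kernel (𝓜 × A) 𝒪) (ν : Measure (𝓜 × A)) (a : A) : Measure 𝒪 :=
  ν.bind (likelihood obs a)

variable [StandardBorelSpace 𝓜] [Nonempty 𝓜] [StandardBorelSpace A] [Nonempty A]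

/-- The marginal Bayesian posterior of `a⋆` under the prior belief `ν`, given that decision `a`
produced the observation `o`.  As always, it is determined by `ν` for almost every `o` with respect
to the predictive law only. -/
def decisionPosterior (obs : Kernel (𝓜 × A) 𝒪) [IsMarkovKernel obs]
    (ν : Measure (𝓜 × A)) [IsFiniteMeasure ν] (a : A) (o : 𝒪) : Measure A :=
  (posterior (likelihood obs a) ν o).map Prod.snd

/-- The joint law of `((a, (M, a⋆)), o)` where `a ∼ p` and `(M, a⋆) ∼ ν` are independent and
`o ∼ obs (M, a)`. -/
def jointLaw (obs : Kernel (𝓜 × A) 𝒪) (p : Measure A) (ν : Measure (𝓜 × A)) :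
    Measure ((A × (𝓜 × A)) × 𝒪) :=
  (p.prod ν) ⊗ₘ (obs.comap (fun x : A × (𝓜 × A) => (x.2.1, x.1))
    ((measurable_fst.comp measurable_snd).prodMk measurable_fst))

/-- The algorithmic information ratio
`E [ f_M (a⋆) - f_M (a) - (1 / η) KL (ν_{a⋆ | a, o}, q) ]`,
with `a ∼ p`, `(M, a⋆) ∼ ν`, `o ∼ obs (M, a)`.  It is used with reference laws `q` charging every
point of the finite set `A`, for which the divergence is finite. -/
def AIR (obs : Kernel (𝓜 × A) 𝒪) [IsMarkovKernel obs] (f : 𝓜 → A → ℝ) (η : ℝ)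
    (q p : Measure A) (ν : Measure (𝓜 × A)) [IsFiniteMeasure ν] : ℝ :=
  ∫ x, (f x.1.2.1 x.1.2.2 - f x.1.2.1 x.1.1
      - 1 / η * (InformationTheory.klDiv (decisionPosterior obs ν x.1.1 x.2) q).toReal)
    ∂(jointLaw obs p ν)

/-- The pairing `⟨∂AIR/∂ν at ν, ν⋆ - ν⟩`: the directional derivative of the belief argument of `AIR`
at `ν` towards `ν⋆`, that is, the limit as `ε ↓ 0` of
`(AIR ((1 - ε) ν + ε ν⋆) - AIR ν) / ε`.  As `AIR` is concave in the belief this limit exists in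
`(-∞, ∞]`, so the lower limit written here is a limit. -/
def airDeriv (obs : Kernel (𝓜 × A) 𝒪) [IsMarkovKernel obs] (f : 𝓜 → A → ℝ) (η : ℝ)
    (q p : Measure A) (ν νs : Measure (𝓜 × A)) [IsFiniteMeasure ν] [IsFiniteMeasure νs] : EReal :=
  liminf (fun ε : ℝ =>
    (((AIR obs f η q p ((1 - ε).toNNReal • ν + ε.toNNReal • νs) - AIR obs f η q p ν) / ε : ℝ) :
      EReal)) (𝓝[>] 0)

/-- The first-order optimality gap of the belief `ν`: the supremum over all beliefs `ν⋆` of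
`⟨∂AIR/∂ν at ν, ν⋆ - ν⟩`. -/
def firstOrderGap (obs : Kernel (𝓜 × A) 𝒪) [IsMarkovKernel obs] (f : 𝓜 → A → ℝ) (η : ℝ)
    (q p : Measure A) (ν : Measure (𝓜 × A)) [IsFiniteMeasure ν] : EReal :=
  ⨆ νs : ProbabilityMeasure (𝓜 × A), airDeriv obs f η q p ν (νs : Measure (𝓜 × A))

end Beliefs

section Game

variable {Ω 𝓜 A 𝒪 : Type*} [MeasurableSpace Ω] [MeasurableSpace 𝓜] [MeasurableSpace A]
  [MeasurableSpace 𝒪]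

/-- Decision–observation histories of length `t`. -/
abbrev History (A 𝒪 : Type*) (t : ℕ) : Type _ := Fin t → A × 𝒪

/-- The history before round `t` (rounds are numbered from `0`). -/
def history (dec : ℕ → Ω → A) (out : ℕ → Ω → 𝒪) (t : ℕ) (ω : Ω) : History A 𝒪 t :=
  fun i => (dec i ω, out i ω)

/-- The law of `(decision, observation)` in a round, given the past history `h` and the model `M`
of the round: the decision is drawn from `p h`, the observation from `obs (M, decision)`. -/
def roundKernel (obs : Kernel (𝓜 × A) 𝒪) {t : ℕ} (p : Kernel (History A 𝒪 t) A) :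
    Kernel (History A 𝒪 t × 𝓜) (A × 𝒪) :=
  (p.comap Prod.fst measurable_fst) ⊗ₖ
    (obs.comap (fun x : (History A 𝒪 t × 𝓜) × A => (x.1.2, x.2))
      ((measurable_snd.comp measurable_fst).prodMk measurable_snd))

/-- `model`, `dec`, `out` (models, decisions, observations) form a `T`-round play of the admissible
algorithm `p` against an adversarial environment: in every round, given the past decisions and
observations and the model selected by the environment, the decision is drawn from the
distribution that the algorithm computes from the past decisions and observations, and the
observation is drawn from the selected model at that decision.  The way in which the environment
selects the models is not restricted: it may be oblivious or adaptive, deterministic or random. -/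
structure IsPlay (obs : Kernel (𝓜 × A) 𝒪) (T : ℕ) (p : (t : ℕ) → Kernel (History A 𝒪 t) A)
    (P : Measure Ω) (model : ℕ → Ω → 𝓜) (dec : ℕ → Ω → A) (out : ℕ → Ω → 𝒪) : Prop where
  measurable_model : ∀ t < T, Measurable (model t)
  measurable_dec : ∀ t < T, Measurable (dec t)
  measurable_out : ∀ t < T, Measurable (out t)
  law_round : ∀ t < T,
    P.map (fun ω => ((history dec out t ω, model t ω), (dec t ω, out t ω)))
      = P.map (fun ω => (history dec out t ω, model t ω)) ⊗ₘ roundKernel obs (p t)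

/-- The frequentist regret `sup_a E [ ∑ f_{M_t} (a) - ∑ f_{M_t} (a_t) ]`. -/
def regret (f : 𝓜 → A → ℝ) (T : ℕ) (P : Measure Ω) (model : ℕ → Ω → 𝓜) (dec : ℕ → Ω → A) : ℝ :=
  ⨆ a : A, ∫ ω, (∑ t ∈ Finset.range T, f (model t ω) a
    - ∑ t ∈ Finset.range T, f (model t ω) (dec t ω)) ∂P

/-- The expectation `E [X⁺] - E [X⁻]` of an extended-real-valued random variable. -/
def extExpectation (P : Measure Ω) (X : Ω → EReal) : EReal :=
  ((∫⁻ ω, (X ω).toENNReal ∂P : ℝ≥0∞) : EReal) - ((∫⁻ ω, (-X ω).toENNReal ∂P : ℝ≥0∞) : EReal)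

end Game

end AlgorithmicBeliefs

end

/-! Fix the comparator `b` and test the supremum over `ν⋆` only at the point mass on `(M_t, b)`. The
reward part of AIR is affine in the belief, and the divergence part has directional derivative
governed by the log loss of the posterior at `b`. This gives, in each round, AIR + gap ≥ `f_M(b) -
E_p f_M + (1/η) log q_t(b) + (1/η) E[-log posterior(b)]`. The last expectation is over `a ∼ p_t` and
`o` drawn from the true model, so it is the conditional mean of `-log q_{t+1}(b)`. Summed over
rounds the log losses telescope; what remains is `-log q_1(b) = log |A|`, and the nonnegative final
loss is dropped. The derivative is never computed. Bayes' rule shows that the posterior of the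
mixture `(1-ε)ν + εδ` is pointwise a mixture of the old posterior and a point mass, so Gibbs'
inequality bounds the difference quotient below by the log loss of the perturbed posterior
(`le_AIR_mixture`). As `ε ↓ 0` that posterior converges almost surely when the true observation law
is dominated by the predictive law, and Fatou's lemma passes to the limit
(`lintegral_negLog_le_liminf`, `le_AIR_add_firstOrderGap_of_ac`). The sums are taken in extended
expectation by `sum_integral_le_add_extExpectation`, which has to establish integrability of the log
losses before cancelling them. -/

noncomputable section

namespace AlgorithmicBeliefs

/-! ### Relative entropy on a finite space and its behaviour under mixing. -/

section FiniteEntropy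

variable {A : Type*} [Fintype A] [MeasurableSpace A] [DiscreteMeasurableSpace A]

lemma sum_measureReal_singleton_eq_one (r : Measure A) [IsProbabilityMeasure r] :
    ∑ b, r.real {b} = 1 := by
  simp

/-- On a finite space, the Kullback–Leibler divergence from a fully supported law is a finite
sum. -/
lemma toReal_klDiv_eq_sum (r q : Measure A) [IsProbabilityMeasure r] [IsProbabilityMeasure q]
    (hq : ∀ b, q {b} ≠ 0) :
    (InformationTheory.klDiv r q).toReal
      = ∑ b, r.real {b} * (Real.log (r.real {b}) - Real.log (q.real {b})) := by
  have hac : r ≪ q := by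
    intro s hs
    have : s = ∅ := by
      by_contra hne
      obtain ⟨b, hb⟩ := Set.nonempty_iff_ne_empty.2 hne
      exact hq b (measure_mono_null (Set.singleton_subset_iff.2 hb) hs)
    simp [this]
  rw [InformationTheory.toReal_klDiv_of_measure_eq hac (by simp),
    integral_fintype (Integrable.of_finite)]
  refine Finset.sum_congr rfl fun b _ => ?_
  rw [smul_eq_mul]
  by_cases hb : r.real {b} = 0
  · simp [hb]
  congr 1
  have hd : r {b} = r.rnDeriv q b * q {b} := by
    conv_lhs => rw [← Measure.withDensity_rnDeriv_eq r q hac]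
    rw [withDensity_apply _ (measurableSet_singleton b), lintegral_singleton]
  have hd' : r.real {b} = (r.rnDeriv q b).toReal * q.real {b} := by
    simp only [Measure.real, hd, ENNReal.toReal_mul]
  rw [llr_def]
  have h1 : (r.rnDeriv q b).toReal ≠ 0 := fun h => hb (by rw [hd', h, zero_mul])
  have h2 : q.real {b} ≠ 0 := fun h => hb (by rw [hd', h, mul_zero])
  simp only
  rw [hd', Real.log_mul h1 h2, add_sub_cancel_right]

/-- Gibbs' inequality behind the concavity of the information ratio: entropy of a mixture of `r`
with a point mass, compared through the cross entropy with respect to the mixture. -/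
lemma sum_mul_log_mixture_le {A : Type*} [Fintype A] [DecidableEq A] {r s l : A → ℝ} {u w : ℝ} {b : A}
    (hr : ∀ c, 0 ≤ r c)
    (hr1 : ∑ c, r c = 1) (hs1 : ∑ c, s c = 1) (hu : 0 ≤ u) (hw : 0 ≤ w)
    (hs : ∀ c, s c = u * r c + w * (if c = b then 1 else 0)) :
    ∑ c, s c * (Real.log (s c) - l c)
      ≤ u * ∑ c, r c * (Real.log (r c) - l c) + w * (Real.log (s b) - l b) := by
  have hsum : ∑ c, s c * (Real.log (s c) - l c)
      = u * ∑ c, r c * (Real.log (s c) - l c) + w * (Real.log (s b) - l b) := by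
    have : ∀ c, s c * (Real.log (s c) - l c) = u * (r c * (Real.log (s c) - l c))
        + (if c = b then w * (Real.log (s c) - l c) else 0) := by
      intro c
      -- The logarithm is frozen so that the decomposition of `s c` is substituted in the linear
      -- factor only.
      generalize Real.log (s c) - l c = z
      rw [hs c]
      split_ifs <;> ring
    rw [Finset.sum_congr rfl fun c _ => this c, Finset.sum_add_distrib, ← Finset.mul_sum]
    simp
  rw [hsum]
  gcongr ?_ + _
  -- For `u = 0` the pointwise bound below may fail: `s c` can vanish where `r c` does not, and
  -- `Real.log 0 = 0`.
  rcases hu.eq_or_lt with rfl | hu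
  · simp
  gcongr u * ?_
  have key : ∀ c, r c * (Real.log (s c) - l c) ≤ r c * (Real.log (r c) - l c) + (s c - r c) := by
    intro c
    have hs0 : 0 ≤ s c := by
      rw [hs c]
      have := hr c
      split_ifs <;> positivity
    rcases (hr c).eq_or_lt with h0 | h0
    · rw [← h0]; simpa using hs0
    have hsc : 0 < s c := by
      rw [hs c]
      have := mul_pos hu h0
      split_ifs <;> linarith
    have h1 := Real.log_le_sub_one_of_pos (div_pos hsc h0)
    rw [Real.log_div hsc.ne' h0.ne'] at h1
    have h2 := mul_le_mul_of_nonneg_left h1 h0.le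
    have h3 : r c * (s c / r c - 1) = s c - r c := by field_simp
    nlinarith
  calc ∑ c, r c * (Real.log (s c) - l c)
      ≤ ∑ c, (r c * (Real.log (r c) - l c) + (s c - r c)) := Finset.sum_le_sum fun c _ => key c
    _ = _ := by rw [Finset.sum_add_distrib, Finset.sum_sub_distrib, hr1, hs1]; ring

variable {𝒪 : Type*} [MeasurableSpace 𝒪]

lemma measurable_sum_mul_log {A : Type*} [Fintype A] [MeasurableSpace A] (R : 𝒪 → Measure A)
    (hR : ∀ b, Measurable fun o => R o {b}) (l : A → ℝ) :
    Measurable fun o => ∑ b, (R o).real {b} * (Real.log ((R o).real {b}) - l b) := by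
  refine Finset.measurable_sum _ fun b _ => ?_
  have h : Measurable fun o => (R o).real {b} := (hR b).ennreal_toReal
  exact h.mul ((Real.measurable_log.comp h).sub_const _)

lemma abs_mul_log_le_one {x : ℝ} (h0 : 0 ≤ x) (h1 : x ≤ 1) : |x * Real.log x| ≤ 1 := by
  rcases h0.eq_or_lt with rfl | h0
  · simp
  have := Real.abs_log_mul_self_lt x h0 h1
  rw [mul_comm]; exact this.le

lemma abs_sum_mul_log_le {A : Type*} [Fintype A] [MeasurableSpace A] (r : Measure A)
    [IsProbabilityMeasure r] (l : A → ℝ) :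
    |∑ b, r.real {b} * (Real.log (r.real {b}) - l b)| ≤ ∑ b, (1 + |l b|) := by
  refine (Finset.abs_sum_le_sum_abs _ _).trans (Finset.sum_le_sum fun b _ => ?_)
  have h0 : 0 ≤ r.real {b} := measureReal_nonneg
  have h1 : r.real {b} ≤ 1 := measureReal_le_one
  rw [mul_sub]
  refine (abs_sub _ _).trans ?_
  refine add_le_add (abs_mul_log_le_one h0 h1) ?_
  rw [abs_mul, abs_of_nonneg h0]
  exact mul_le_of_le_one_left (abs_nonneg _) h1

lemma integrable_of_bounded {X : Type*} [MeasurableSpace X] {μ : Measure X} [IsFiniteMeasure μ]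
    {g : X → ℝ} (hg : Measurable g) (C : ℝ) (h : ∀ x, |g x| ≤ C) : Integrable g μ :=
  Integrable.of_bound hg.aestronglyMeasurable C (Eventually.of_forall h)

variable {ν₀ m : Measure 𝒪} [IsProbabilityMeasure ν₀] [IsProbabilityMeasure m]

/-- `U` and `W` are the densities of the two components with respect to their sum `c • ν₀ + d • m`.
Working relative to the sum makes the posterior `S` a pointwise convex combination of `R` and the
point mass at `b` without any domination of `m` by `ν₀`. -/
lemma exists_mixture_weights {A : Type*} [MeasurableSpace A] [Countable A] [DecidableEq A]
    {R S : 𝒪 → Measure A}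
    (hR : ∀ b, Measurable fun o => R o {b}) (hS : ∀ b, Measurable fun o => S o {b})
    {c d : ℝ≥0} {b : A}
    (h : ∀ b', (c • ν₀ + d • m).withDensity (fun o => S o {b'})
      = c • ν₀.withDensity (fun o => R o {b'}) + d • (if b' = b then m else 0)) :
    ∃ U W : 𝒪 → ℝ≥0∞, Measurable U ∧ Measurable W
      ∧ (c • ν₀ + d • m).withDensity U = c • ν₀ ∧ (c • ν₀ + d • m).withDensity W = d • m
      ∧ ∀ᵐ o ∂(c • ν₀ + d • m), U o + W o = 1
        ∧ ∀ b', S o {b'} = U o * R o {b'} + W o * (if b' = b then 1 else 0) := by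
  set ρ : Measure 𝒪 := c • ν₀ + d • m with hρ
  have hac1 : c • ν₀ ≪ ρ := by rw [hρ]; exact Measure.AbsolutelyContinuous.rfl.add_right _
  have hac2 : d • m ≪ ρ := by
    rw [hρ, add_comm]; exact Measure.AbsolutelyContinuous.rfl.add_right _
  set U := (c • ν₀).rnDeriv ρ with hU
  set W := (d • m).rnDeriv ρ with hW
  have mU : Measurable U := Measure.measurable_rnDeriv _ _
  have mW : Measurable W := Measure.measurable_rnDeriv _ _
  have eU : ρ.withDensity U = c • ν₀ := Measure.withDensity_rnDeriv_eq _ _ hac1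
  have eW : ρ.withDensity W = d • m := Measure.withDensity_rnDeriv_eq _ _ hac2
  refine ⟨U, W, mU, mW, eU, eW, ?_⟩
  have h1 : U + W =ᵐ[ρ] 1 := by
    rw [← withDensity_eq_iff_of_sigmaFinite (mU.add mW).aemeasurable measurable_one.aemeasurable,
      withDensity_add_left mU, eU, eW, withDensity_one]
  have h2 : ∀ b', (fun o => S o {b'}) =ᵐ[ρ]
      (U * fun o => R o {b'}) + (W * fun _ => (if b' = b then (1 : ℝ≥0∞) else 0)) := by
    intro b'
    have key : ρ.withDensity
        ((U * fun o => R o {b'}) + (W * fun _ => (if b' = b then (1 : ℝ≥0∞) else 0)))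
        = c • ν₀.withDensity (fun o => R o {b'}) + d • (if b' = b then m else 0) := by
      rw [withDensity_add_left (mU.mul (hR b')), withDensity_mul _ mU (hR b'), eU,
        withDensity_mul _ mW measurable_const, eW]
      congr 1
      · exact withDensity_smul_measure (c : ℝ≥0∞) _
      · split_ifs with hb
        · exact withDensity_one
        · rw [smul_zero]; exact withDensity_zero
    exact (withDensity_eq_iff_of_sigmaFinite (hS b').aemeasurable
      ((mU.mul (hR b')).add (mW.mul measurable_const)).aemeasurable).1 ((h b').trans key.symm)
  filter_upwards [h1, ae_all_iff.2 h2] with o h1 h2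
  exact ⟨h1, h2⟩

variable {R S : 𝒪 → Measure A} [∀ o, IsProbabilityMeasure (R o)] [∀ o, IsProbabilityMeasure (S o)]

/-- The pointwise mixture inequality is integrated against the mixed law, and the weights turn back
into `c • ν₀` and `d • m`. The first two conclusions say that mixing in a positive mass `d` at `b`
already makes the log loss at `b` finite in mean under `m`. -/
lemma integral_klDiv_mixture_le [DecidableEq A] {q : Measure A} [IsProbabilityMeasure q]
    (hq : ∀ b, q {b} ≠ 0)
    (hR : ∀ b, Measurable fun o => R o {b}) (hS : ∀ b, Measurable fun o => S o {b})
    {c d : ℝ≥0} (hd : 0 < d) {b : A}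
    (h : ∀ b', (c • ν₀ + d • m).withDensity (fun o => S o {b'})
      = c • ν₀.withDensity (fun o => R o {b'}) + d • (if b' = b then m else 0)) :
    Integrable (fun o => Real.log ((S o).real {b})) m ∧
    (∀ᵐ o ∂m, S o {b} ≠ 0) ∧
    ∫ o, (InformationTheory.klDiv (S o) q).toReal ∂(c • ν₀ + d • m)
      ≤ c * ∫ o, (InformationTheory.klDiv (R o) q).toReal ∂ν₀
        + d * ∫ o, (Real.log ((S o).real {b}) - Real.log (q.real {b})) ∂m := by
  obtain ⟨U, W, mU, mW, eU, eW, hae⟩ := exists_mixture_weights hR hS h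
  set ρ : Measure 𝒪 := c • ν₀ + d • m with hρ
  simp only [toReal_klDiv_eq_sum _ _ hq]
  set l : A → ℝ := fun b => Real.log (q.real {b}) with hl
  have fU : ∀ᵐ o ∂ρ, U o < ∞ := by
    filter_upwards [hae] with o ho
    exact lt_of_le_of_lt (le_self_add.trans ho.1.le) ENNReal.one_lt_top
  have fW : ∀ᵐ o ∂ρ, W o < ∞ := by
    filter_upwards [hae] with o ho
    exact lt_of_le_of_lt (le_add_self.trans ho.1.le) ENNReal.one_lt_top
  have mSb : Measurable fun o => (S o).real {b} := (hS b).ennreal_toReal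
  have mlog : Measurable fun o => Real.log ((S o).real {b}) := Real.measurable_log.comp mSb
  have hreal : ∀ᵐ o ∂ρ, (U o).toReal + (W o).toReal = 1 ∧
      ∀ b', (S o).real {b'}
        = (U o).toReal * (R o).real {b'} + (W o).toReal * (if b' = b then 1 else 0) := by
    filter_upwards [hae, fU, fW] with o ho hu hw
    refine ⟨by rw [← ENNReal.toReal_add hu.ne hw.ne, ho.1, ENNReal.toReal_one], fun b' => ?_⟩
    simp only [Measure.real]
    rw [ho.2 b', ENNReal.toReal_add (ENNReal.mul_ne_top hu.ne (by finiteness))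
      (ENNReal.mul_ne_top hw.ne (by split_ifs <;> simp)), ENNReal.toReal_mul, ENNReal.toReal_mul]
    split_ifs <;> simp
  have iW : Integrable (fun o => Real.log ((S o).real {b}) * (W o).toReal) ρ := by
    refine Integrable.of_bound (mlog.mul mW.ennreal_toReal).aestronglyMeasurable 1 ?_
    filter_upwards [hreal] with o ho
    have h0 : 0 ≤ (W o).toReal := ENNReal.toReal_nonneg
    have h1 : (S o).real {b} ≤ 1 := measureReal_le_one
    -- The weight is dominated by the posterior mass of `b`, so the weighted log loss is controlled
    -- by the bounded function `x log x`.
    have h2 : (W o).toReal ≤ (S o).real {b} := by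
      rw [ho.2 b, if_pos rfl, mul_one]
      have := mul_nonneg (ENNReal.toReal_nonneg (a := U o)) (measureReal_nonneg (μ := R o) (s := {b}))
      linarith
    rw [Real.norm_eq_abs, abs_mul, abs_of_nonneg h0]
    calc |Real.log ((S o).real {b})| * (W o).toReal
        ≤ |Real.log ((S o).real {b})| * (S o).real {b} := by gcongr
      _ = |(S o).real {b} * Real.log ((S o).real {b})| := by
          rw [abs_mul, abs_of_nonneg measureReal_nonneg, mul_comm]
      _ ≤ 1 := abs_mul_log_le_one measureReal_nonneg h1
  have idm : Integrable (fun o => Real.log ((S o).real {b})) (d • m) := by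
    rw [← eW, integrable_withDensity_iff mW fW]
    exact iW
  have im : Integrable (fun o => Real.log ((S o).real {b})) m :=
    (integrable_smul_measure (c := (d : ℝ≥0∞)) (by simpa using hd.ne') (by simp)).1 idm
  have mm : m ≪ d • m := Measure.absolutelyContinuous_smul (c := (d : ℝ≥0∞)) (by simpa using hd.ne')
  refine ⟨im, mm.ae_le ?_, ?_⟩
  · change ∀ᵐ o ∂(d • m), S o {b} ≠ 0
    rw [← eW, ae_withDensity_iff mW]
    filter_upwards [hae] with o ho hW0
    rw [ho.2 b, if_pos rfl, mul_one]
    exact fun h0 => hW0 (add_eq_zero.1 h0).2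
  have e1 : (c : ℝ) * ∫ o, ∑ b, (R o).real {b} * (Real.log ((R o).real {b}) - l b) ∂ν₀
      = ∫ o, (U o).toReal * ∑ b, (R o).real {b} * (Real.log ((R o).real {b}) - l b) ∂ρ := by
    have := integral_withDensity_eq_integral_toReal_smul mU fU
      (fun o => ∑ b, (R o).real {b} * (Real.log ((R o).real {b}) - l b))
    rw [eU, integral_smul_nnreal_measure] at this
    simpa [NNReal.smul_def] using this
  have e2 : (d : ℝ) * ∫ o, (Real.log ((S o).real {b}) - l b) ∂m
      = ∫ o, (W o).toReal * (Real.log ((S o).real {b}) - l b) ∂ρ := by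
    have := integral_withDensity_eq_integral_toReal_smul mW fW
      (fun o => Real.log ((S o).real {b}) - l b)
    rw [eW, integral_smul_nnreal_measure] at this
    simpa [NNReal.smul_def] using this
  have i1 : Integrable (fun o => (U o).toReal *
      ∑ b, (R o).real {b} * (Real.log ((R o).real {b}) - l b)) ρ := by
    refine Integrable.of_bound (mU.ennreal_toReal.mul
      (measurable_sum_mul_log R hR l)).aestronglyMeasurable (∑ b, (1 + |l b|)) ?_
    filter_upwards [hreal] with o ho
    have h0 : 0 ≤ (U o).toReal := ENNReal.toReal_nonneg
    have hw0 : 0 ≤ (W o).toReal := ENNReal.toReal_nonneg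
    rw [Real.norm_eq_abs, abs_mul, abs_of_nonneg h0]
    exact (mul_le_of_le_one_left (abs_nonneg _) (by linarith [ho.1])).trans
      (abs_sum_mul_log_le (R o) l)
  have i2 : Integrable (fun o => (W o).toReal * (Real.log ((S o).real {b}) - l b)) ρ := by
    have hWi : Integrable (fun o => (W o).toReal) ρ := by
      refine Integrable.of_bound mW.ennreal_toReal.aestronglyMeasurable 1 ?_
      filter_upwards [hreal] with o ho
      have h0 : 0 ≤ (U o).toReal := ENNReal.toReal_nonneg
      rw [Real.norm_eq_abs, abs_of_nonneg ENNReal.toReal_nonneg]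
      linarith [ho.1]
    refine (iW.sub (hWi.mul_const (l b))).congr (Eventually.of_forall fun o => ?_)
    simp only [Pi.sub_apply]; ring
  rw [show (Real.log (q.real {b})) = l b from rfl, e1, e2, ← integral_add i1 i2]
  refine integral_mono_ae
    (integrable_of_bounded (measurable_sum_mul_log S hS l) _ fun o => abs_sum_mul_log_le (S o) l)
    (i1.add i2) ?_
  filter_upwards [hreal] with o ho
  exact sum_mul_log_mixture_le (fun _ => measureReal_nonneg)
    (sum_measureReal_singleton_eq_one (R o)) (sum_measureReal_singleton_eq_one (S o))
    ENNReal.toReal_nonneg ENNReal.toReal_nonneg ho.2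

end FiniteEntropy

/-! ### Predictive laws and Bayes' rule. -/

section Posterior

variable {𝓜 A 𝒪 : Type*} [MeasurableSpace 𝓜] [MeasurableSpace A] [MeasurableSpace 𝒪]

instance isProbabilityMeasure_predictive (obs : Kernel (𝓜 × A) 𝒪) [IsMarkovKernel obs]
    (μ : Measure (𝓜 × A)) [IsProbabilityMeasure μ] (a : A) :
    IsProbabilityMeasure (predictive obs μ a) := by
  unfold predictive; infer_instance

lemma predictive_add_smul (obs : Kernel (𝓜 × A) 𝒪) (μ μ' : Measure (𝓜 × A)) (c d : ℝ≥0) (a : A) :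
    predictive obs (c • μ + d • μ') a = c • predictive obs μ a + d • predictive obs μ' a := by
  unfold predictive
  rw [Measure.comp_add]
  congr 1
  · exact Measure.comp_smul (c : ℝ≥0∞)
  · exact Measure.comp_smul (d : ℝ≥0∞)

lemma predictive_dirac (obs : Kernel (𝓜 × A) 𝒪) (x : 𝓜 × A) (a : A) :
    predictive obs (Measure.dirac x) a = obs (x.1, a) := by
  unfold predictive
  rw [Measure.dirac_bind (Kernel.measurable _), likelihood, Kernel.comap_apply]

lemma measurable_uncurry_reward [Countable A] [MeasurableSingletonClass A] {f : 𝓜 → A → ℝ}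
    (hf : ∀ a, Measurable fun M => f M a) : Measurable fun x : 𝓜 × A => f x.1 x.2 :=
  measurable_from_prod_countable_left hf

lemma integral_predictive (obs : Kernel (𝓜 × A) 𝒪) [IsMarkovKernel obs]
    (μ : Measure (𝓜 × A)) [IsFiniteMeasure μ] (a : A) {g : 𝒪 → ℝ}
    (hg : Integrable g (predictive obs μ a)) :
    ∫ o, g o ∂(predictive obs μ a) = ∫ x, ∫ o, g o ∂(obs (x.1, a)) ∂μ := by
  unfold predictive at hg ⊢
  have h1 : Integrable (fun z : (𝓜 × A) × 𝒪 => g z.2) (μ ⊗ₘ likelihood obs a) :=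
    (Measure.integrable_compProd_snd_iff hg.1).2 hg
  have h2 : ∫ o, g o ∂(μ.bind (likelihood obs a)) = ∫ z, g z.2 ∂(μ ⊗ₘ likelihood obs a) := by
    rw [← Measure.snd_compProd] at hg ⊢
    rw [Measure.snd, integral_map measurable_snd.aemeasurable hg.1]
  rw [h2, Measure.integral_compProd h1]
  rfl

variable [StandardBorelSpace 𝓜] [Nonempty 𝓜] [StandardBorelSpace A] [Nonempty A]
  (obs : Kernel (𝓜 × A) 𝒪) [IsMarkovKernel obs]

instance isProbabilityMeasure_decisionPosterior (μ : Measure (𝓜 × A)) [IsFiniteMeasure μ] (a : A)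
    (o : 𝒪) : IsProbabilityMeasure (decisionPosterior obs μ a o) := by
  unfold decisionPosterior
  exact Measure.isProbabilityMeasure_map measurable_snd.aemeasurable

lemma measurable_decisionPosterior (μ : Measure (𝓜 × A)) [IsFiniteMeasure μ] (a b : A) :
    Measurable fun o => decisionPosterior obs μ a o {b} := by
  have : ∀ o, decisionPosterior obs μ a o {b}
      = posterior (likelihood obs a) μ o (Prod.snd ⁻¹' {b}) := fun o => by
    rw [decisionPosterior, Measure.map_apply measurable_snd (measurableSet_singleton b)]
  simp_rw [this]
  exact Kernel.measurable_coe _ (measurable_snd (measurableSet_singleton b))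

/-- Bayes' rule: the part of the predictive law carried by the decision `b` has density the
posterior mass of `b`. -/
lemma withDensity_decisionPosterior (μ : Measure (𝓜 × A)) [IsFiniteMeasure μ] (a b : A) :
    (predictive obs μ a).withDensity (fun o => decisionPosterior obs μ a o {b})
      = predictive obs (μ.restrict (Prod.snd ⁻¹' {b})) a := by
  have hb : MeasurableSet (Prod.snd ⁻¹' {b} : Set (𝓜 × A)) :=
    measurable_snd (measurableSet_singleton b)
  ext s hs
  rw [withDensity_apply _ hs, predictive, predictive, Measure.bind_apply hs (Kernel.aemeasurable _)]
  -- The two disintegrations of the joint law of pair and observation are compared on a rectangle.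
  have h := congrArg (fun ρ => ρ (s ×ˢ (Prod.snd ⁻¹' {b})))
    (compProd_posterior_eq_map_swap (κ := likelihood obs a) (μ := μ))
  beta_reduce at h
  rw [Measure.compProd_apply_prod hs hb, Measure.map_apply measurable_swap (hs.prod hb),
    Set.preimage_swap_prod, Measure.compProd_apply_prod hb hs] at h
  rw [← h]
  refine lintegral_congr fun o => ?_
  rw [decisionPosterior, Measure.map_apply measurable_snd (measurableSet_singleton b)]

/-- Bayes' rule for the mixture of a belief with a point mass. -/
lemma withDensity_decisionPosterior_mixture [DecidableEq A] (μ : Measure (𝓜 × A))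
    [IsFiniteMeasure μ] (c d : ℝ≥0) (M : 𝓜) (a b b' : A) :
    (c • predictive obs μ a + d • obs (M, a)).withDensity
        (fun o => decisionPosterior obs (c • μ + d • Measure.dirac (M, b)) a o {b'})
      = c • (predictive obs μ a).withDensity (fun o => decisionPosterior obs μ a o {b'})
        + d • (if b' = b then obs (M, a) else 0) := by
  have e : c • predictive obs μ a + d • obs (M, a)
      = predictive obs (c • μ + d • Measure.dirac (M, b)) a := by
    rw [predictive_add_smul, predictive_dirac]
  rw [e, withDensity_decisionPosterior, withDensity_decisionPosterior, Measure.restrict_add,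
    Measure.restrict_smul, Measure.restrict_smul, predictive_add_smul]
  congr 2
  classical
  rw [restrict_dirac' (measurable_snd (measurableSet_singleton b'))]
  by_cases h : b' = b
  · subst h; simp [predictive_dirac]
  · have h' : b ≠ b' := fun h' => h h'.symm
    simp [h, h', predictive]

end Posterior

/-! ### The information ratio as a finite sum. -/

section Ratio

variable {𝓜 A 𝒪 : Type*} [MeasurableSpace 𝓜] [MeasurableSpace 𝒪]
  [StandardBorelSpace 𝓜] [Nonempty 𝓜]
  [Fintype A] [Nonempty A] [MeasurableSpace A] [DiscreteMeasurableSpace A]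
  (obs : Kernel (𝓜 × A) 𝒪) [IsMarkovKernel obs]
  {f : 𝓜 → A → ℝ} {C : ℝ}

lemma measurable_klDiv_decisionPosterior {q : Measure A} [IsProbabilityMeasure q]
    (hq : ∀ b, q {b} ≠ 0) (μ : Measure (𝓜 × A)) [IsFiniteMeasure μ] (a : A) :
    Measurable fun o => (InformationTheory.klDiv (decisionPosterior obs μ a o) q).toReal := by
  simp only [toReal_klDiv_eq_sum _ _ hq]
  exact measurable_sum_mul_log _ (measurable_decisionPosterior obs μ a) _

lemma abs_klDiv_decisionPosterior_le {q : Measure A} [IsProbabilityMeasure q]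
    (hq : ∀ b, q {b} ≠ 0) (μ : Measure (𝓜 × A)) [IsFiniteMeasure μ] (a : A) (o : 𝒪) :
    |(InformationTheory.klDiv (decisionPosterior obs μ a o) q).toReal|
      ≤ ∑ b, (1 + |Real.log (q.real {b})|) := by
  rw [toReal_klDiv_eq_sum _ _ hq]
  exact abs_sum_mul_log_le _ _

/-- The information ratio as a finite sum over the decisions. -/
lemma AIR_eq_sum (hf : ∀ a, Measurable fun M => f M a) (hC : ∀ M a, |f M a| ≤ C) (η : ℝ)
    (q p : Measure A) [IsProbabilityMeasure q] [IsProbabilityMeasure p]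
    (hq : ∀ b, q {b} ≠ 0) (μ : Measure (𝓜 × A)) [IsProbabilityMeasure μ] :
    AIR obs f η q p μ = ∑ a, p.real {a} * (∫ x, (f x.1 x.2 - f x.1 a) ∂μ
      - 1 / η * ∫ o, (InformationTheory.klDiv (decisionPosterior obs μ a o) q).toReal
          ∂(predictive obs μ a)) := by
  set k : A → 𝒪 → ℝ := fun a o => (InformationTheory.klDiv (decisionPosterior obs μ a o) q).toReal
    with hk
  set B := ∑ b, (1 + |Real.log (q.real {b})|) with hB
  have mk : ∀ a, Measurable (k a) := fun a => measurable_klDiv_decisionPosterior obs hq μ a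
  have bk : ∀ a o, |k a o| ≤ B := fun a o => abs_klDiv_decisionPosterior_le obs hq μ a o
  have mg : ∀ a, Measurable fun x : 𝓜 × A => f x.1 x.2 - f x.1 a := fun a =>
    (measurable_uncurry_reward hf).sub ((hf a).comp measurable_fst)
  have bg : ∀ a (x : 𝓜 × A), |f x.1 x.2 - f x.1 a| ≤ C + C := fun a x =>
    (abs_sub _ _).trans (add_le_add (hC _ _) (hC _ _))
  have mΦ : Measurable fun z : (A × (𝓜 × A)) × 𝒪 =>
      f z.1.2.1 z.1.2.2 - f z.1.2.1 z.1.1 - 1 / η * k z.1.1 z.2 := by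
    refine Measurable.sub (Measurable.sub ?_ ?_) (measurable_const.mul ?_)
    · exact (measurable_uncurry_reward hf).comp (measurable_snd.comp measurable_fst)
    · exact (measurable_uncurry_reward hf).comp
        ((measurable_fst.comp (measurable_snd.comp measurable_fst)).prodMk
          (measurable_fst.comp measurable_fst))
    · have : Measurable fun w : A × 𝒪 => k w.1 w.2 := measurable_from_prod_countable_right mk
      exact this.comp ((measurable_fst.comp measurable_fst).prodMk measurable_snd)
  -- Since `q` has full support, the divergence is bounded uniformly in the posterior; boundedness
  -- of the integrand justifies every use of Fubini below.
  have bΦ : ∀ z : (A × (𝓜 × A)) × 𝒪,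
      |f z.1.2.1 z.1.2.2 - f z.1.2.1 z.1.1 - 1 / η * k z.1.1 z.2| ≤ C + C + |1 / η| * B := by
    intro z
    refine (abs_sub _ _).trans (add_le_add (bg _ _) ?_)
    rw [abs_mul]
    exact mul_le_mul_of_nonneg_left (bk _ _) (abs_nonneg _)
  unfold AIR jointLaw
  rw [Measure.integral_compProd (integrable_of_bounded mΦ _ bΦ)]
  simp only [Kernel.comap_apply]
  have ik : ∀ a (ρ : Measure 𝒪) [IsFiniteMeasure ρ], Integrable (k a) ρ := fun a ρ _ =>
    integrable_of_bounded (mk a) B (bk a)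
  have inner : ∀ y : A × (𝓜 × A), ∫ o, (f y.2.1 y.2.2 - f y.2.1 y.1 - 1 / η * k y.1 o)
        ∂(obs (y.2.1, y.1))
      = f y.2.1 y.2.2 - f y.2.1 y.1 - 1 / η * ∫ o, k y.1 o ∂(obs (y.2.1, y.1)) := by
    intro y
    rw [integral_sub (integrable_const _) ((ik _ _).const_mul _), integral_const_mul]
    simp
  rw [integral_congr_ae (Eventually.of_forall inner)]
  have mK : ∀ a, Measurable fun x : 𝓜 × A => ∫ o, k a o ∂(obs (x.1, a)) := fun a => by
    have : StronglyMeasurable fun x : 𝓜 × A => ∫ o, k a o ∂(likelihood obs a x) :=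
      (mk a).stronglyMeasurable.integral_kernel
    exact this.measurable
  have bK : ∀ a (x : 𝓜 × A), |∫ o, k a o ∂(obs (x.1, a))| ≤ B := fun a x => by
    have := norm_integral_le_of_norm_le_const (μ := obs (x.1, a)) (f := k a) (C := B)
      (Eventually.of_forall fun o => bk a o)
    simpa using this
  rw [integral_prod]
  · rw [integral_fintype Integrable.of_finite]
    refine Finset.sum_congr rfl fun a _ => ?_
    rw [smul_eq_mul, integral_sub (integrable_of_bounded (mg a) _ (bg a))
      ((integrable_of_bounded (mK a) _ (bK a)).const_mul _), integral_const_mul,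
      ← integral_predictive obs μ a (ik a _)]
  · refine integrable_of_bounded (C := C + C + |1 / η| * B) ?_ ?_
    · exact measurable_from_prod_countable_right fun a => (mg a).sub ((mK a).const_mul _)
    · intro y
      refine (abs_sub _ _).trans (add_le_add (bg _ _) ?_)
      rw [abs_mul]
      exact mul_le_mul_of_nonneg_left (bK _ _) (abs_nonneg _)

end Ratio

/-! ### Log loss and its lower semicontinuity along mixtures. -/

/-- Minus the logarithm of a probability, with the value `∞` at `0`. -/
def negLog (x : ℝ≥0∞) : ℝ≥0∞ := (-ENNReal.log x).toENNReal

lemma continuous_negLog : Continuous negLog :=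
  EReal.continuous_toENNReal.comp (continuous_neg.comp ENNReal.continuous_log)

lemma measurable_negLog : Measurable negLog := continuous_negLog.measurable

lemma negLog_eq_ofReal {x : ℝ≥0∞} (h0 : x ≠ 0) (h : x ≠ ∞) :
    negLog x = ENNReal.ofReal (-Real.log x.toReal) := by
  rw [negLog, ENNReal.log_pos_real h0 h, ← EReal.coe_neg, EReal.real_coe_toENNReal]

section Fatou

variable {𝒪 : Type*} [MeasurableSpace 𝒪] {ν₀ m : Measure 𝒪} [IsFiniteMeasure ν₀]
  [IsFiniteMeasure m]

/-- With `g` the density of `m` relative to `ν₀`, both sides of `h` have densities relative to `ν₀`,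
so `(c + d g) S = c r + d g` almost everywhere; the factor is nonzero because `c ≠ 0` and finite
because `g` is. -/
lemma mixture_density_ae_eq (hm : m ≪ ν₀) {r S : 𝒪 → ℝ≥0∞} (hr : Measurable r)
    (hS : Measurable S) {c d : ℝ≥0} (hc : c ≠ 0)
    (h : (c • ν₀ + d • m).withDensity S = c • ν₀.withDensity r + d • m) :
    ∀ᵐ o ∂ν₀, S o = (c * r o + d * m.rnDeriv ν₀ o) / (c + d * m.rnDeriv ν₀ o) := by
  set g := m.rnDeriv ν₀ with hg
  have mg : Measurable g := Measure.measurable_rnDeriv _ _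
  have eg : ν₀.withDensity g = m := Measure.withDensity_rnDeriv_eq _ _ hm
  have mc : Measurable fun _ : 𝒪 => (c : ℝ≥0∞) := measurable_const
  have mdg : Measurable ((d : ℝ≥0∞) • g) := mg.const_smul (d : ℝ≥0∞)
  have edg : ν₀.withDensity ((d : ℝ≥0∞) • g) = d • m := by
    rw [withDensity_smul _ mg, eg]; rfl
  have e1 : ν₀.withDensity ((fun _ => (c : ℝ≥0∞)) + (d : ℝ≥0∞) • g) = c • ν₀ + d • m := by
    rw [withDensity_add_left mc, edg, withDensity_const]; rfl
  have e2 : ν₀.withDensity ((c : ℝ≥0∞) • r + (d : ℝ≥0∞) • g)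
      = c • ν₀.withDensity r + d • m := by
    rw [withDensity_add_left (hr.const_smul (c : ℝ≥0∞)), edg, withDensity_smul _ hr]; rfl
  have e3 : ν₀.withDensity (((fun _ => (c : ℝ≥0∞)) + (d : ℝ≥0∞) • g) * S)
      = ν₀.withDensity ((c : ℝ≥0∞) • r + (d : ℝ≥0∞) • g) := by
    rw [withDensity_mul _ (mc.add mdg) hS, e1, e2, h]
  have e4 := (withDensity_eq_iff_of_sigmaFinite ((mc.add mdg).mul hS).aemeasurable
    ((hr.const_smul (c : ℝ≥0∞)).add mdg).aemeasurable).1 e3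
  filter_upwards [e4, Measure.rnDeriv_lt_top m ν₀] with o ho hgo
  have ho' : (c + d * g o) * S o = c * r o + d * g o := ho
  rw [← ho', mul_comm]
  refine (ENNReal.mul_div_cancel_right ?_ ?_).symm
  · exact fun h0 => hc (by simpa using (add_eq_zero.1 h0).1)
  · exact ENNReal.add_ne_top.2 ⟨by simp, ENNReal.mul_ne_top (by simp) hgo.ne⟩

lemma tendsto_mixture_density (r : ℝ≥0∞) {g : ℝ≥0∞} (hg : g ≠ ∞) :
    Tendsto (fun ε : ℝ => (((1 - ε).toNNReal : ℝ≥0∞) * r + (ε.toNNReal : ℝ≥0∞) * g)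
      / (((1 - ε).toNNReal : ℝ≥0∞) + (ε.toNNReal : ℝ≥0∞) * g)) (𝓝[>] 0) (𝓝 r) := by
  have hc : Tendsto (fun ε : ℝ => ((1 - ε).toNNReal : ℝ≥0∞)) (𝓝[>] 0) (𝓝 1) := by
    have : Continuous fun ε : ℝ => ((1 - ε).toNNReal : ℝ≥0∞) := by fun_prop
    simpa using (this.tendsto 0).mono_left nhdsWithin_le_nhds
  have hd : Tendsto (fun ε : ℝ => (ε.toNNReal : ℝ≥0∞)) (𝓝[>] 0) (𝓝 0) := by
    have : Continuous fun ε : ℝ => (ε.toNNReal : ℝ≥0∞) := by fun_prop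
    simpa using (this.tendsto 0).mono_left nhdsWithin_le_nhds
  have hdg := ENNReal.Tendsto.mul_const hd (Or.inr hg)
  have hcr := ENNReal.Tendsto.mul_const (b := r) hc (Or.inl one_ne_zero)
  have := ENNReal.Tendsto.div (hcr.add hdg) (Or.inr (by simp)) (hc.add hdg) (Or.inl (by simp))
  simpa using this

/-- Lower semicontinuity of the expected log loss under mixing, in the direction of a law dominated
by the predictive law. -/
lemma lintegral_negLog_le_liminf (hm : m ≪ ν₀) {r : 𝒪 → ℝ≥0∞} {S : ℝ → 𝒪 → ℝ≥0∞}
    (hr : Measurable r) (hS : ∀ ε, Measurable (S ε))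
    (h : ∀ ε : ℝ, 0 < ε → ε < 1 → ((1 - ε).toNNReal • ν₀ + ε.toNNReal • m).withDensity (S ε)
      = (1 - ε).toNNReal • ν₀.withDensity r + ε.toNNReal • m) :
    ∫⁻ o, negLog (r o) ∂m ≤ liminf (fun ε => ∫⁻ o, negLog (S ε o) ∂m) (𝓝[>] (0 : ℝ)) := by
  set s : ℝ → 𝒪 → ℝ≥0∞ := fun ε o =>
    (((1 - ε).toNNReal : ℝ≥0∞) * r o + (ε.toNNReal : ℝ≥0∞) * m.rnDeriv ν₀ o)
      / (((1 - ε).toNNReal : ℝ≥0∞) + (ε.toNNReal : ℝ≥0∞) * m.rnDeriv ν₀ o) with hs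
  have ms : ∀ ε, Measurable (s ε) := fun ε => by
    have := Measure.measurable_rnDeriv m ν₀
    fun_prop
  have hlt : ∀ᶠ ε : ℝ in 𝓝[>] 0, ε < 1 :=
    nhdsWithin_le_nhds (eventually_lt_nhds one_pos)
  -- Each `S ε` is known only off a null set depending on `ε`, and there are uncountably many `ε`.
  -- Replacing it by the explicit version `s ε` inside the integral gives pointwise convergence off
  -- one null set, as Fatou's lemma requires.
  have e1 : liminf (fun ε => ∫⁻ o, negLog (S ε o) ∂m) (𝓝[>] (0 : ℝ))
      = liminf (fun ε => ∫⁻ o, negLog (s ε o) ∂m) (𝓝[>] (0 : ℝ)) := by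
    refine liminf_congr ?_
    filter_upwards [hlt, self_mem_nhdsWithin] with ε h1 h0
    refine lintegral_congr_ae (hm.ae_le ?_)
    have := mixture_density_ae_eq hm hr (hS ε) (by simpa using h1) (h ε h0 h1)
    filter_upwards [this] with o ho
    simp only [ho, hs]
  rw [e1]
  refine le_trans (lintegral_mono_ae (hm.ae_le ?_))
    (lintegral_liminf_le' fun ε => (measurable_negLog.comp (ms ε)).aemeasurable)
  filter_upwards [Measure.rnDeriv_lt_top m ν₀] with o ho
  exact (((continuous_negLog.tendsto _).comp
    (tendsto_mixture_density (r o) ho.ne)).liminf_eq).ge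

end Fatou

/-! ### Lower bounds for the first-order gap at point masses. -/

section Gap

variable {𝓜 A 𝒪 : Type*} [MeasurableSpace 𝓜] [MeasurableSpace 𝒪]
  [StandardBorelSpace 𝓜] [Nonempty 𝓜]
  [Fintype A] [Nonempty A] [MeasurableSpace A] [DiscreteMeasurableSpace A]
  (obs : Kernel (𝓜 × A) 𝒪) [IsMarkovKernel obs] {f : 𝓜 → A → ℝ} {C : ℝ}

/-- The information ratio of a mixture with a point mass is bounded below by the linear
interpolation with the expected log loss of the mixture at that point. -/
lemma le_AIR_mixture (hf : ∀ a, Measurable fun M => f M a) (hC : ∀ M a, |f M a| ≤ C) {η : ℝ}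
    (hη : 0 < η) (q p : Measure A) [IsProbabilityMeasure q] [IsProbabilityMeasure p]
    (hq : ∀ b, q {b} ≠ 0) (ν : Measure (𝓜 × A)) [IsProbabilityMeasure ν] (M : 𝓜) (b : A)
    {c d : ℝ≥0} (hd : 0 < d) (hcd : c + d = 1) :
    c * AIR obs f η q p ν + d * ((f M b - ∑ a, p.real {a} * f M a + Real.log (q.real {b}) / η)
      + 1 / η * (∫⁻ a, ∫⁻ o, negLog
          (decisionPosterior obs (c • ν + d • Measure.dirac (M, b)) a o {b}) ∂(obs (M, a)) ∂p).toReal)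
      ≤ AIR obs f η q p (c • ν + d • Measure.dirac (M, b))
    ∧ ∫⁻ a, ∫⁻ o, negLog
          (decisionPosterior obs (c • ν + d • Measure.dirac (M, b)) a o {b}) ∂(obs (M, a)) ∂p ≠ ∞ := by
  classical
  set με := c • ν + d • Measure.dirac (M, b) with hμε
  have : IsProbabilityMeasure με := ⟨by
    simp only [hμε, Measure.add_apply, Measure.smul_apply, measure_univ, ENNReal.smul_def,
      smul_eq_mul, mul_one]
    exact_mod_cast hcd⟩
  have key := fun a => integral_klDiv_mixture_le (ν₀ := predictive obs ν a) (m := obs (M, a))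
    (R := decisionPosterior obs ν a) (S := decisionPosterior obs με a) hq
    (fun b => measurable_decisionPosterior obs ν a b)
    (fun b => measurable_decisionPosterior obs με a b) (c := c) (d := d) hd (b := b)
    (fun b' => withDensity_decisionPosterior_mixture obs ν c d M a b b')
  have epred : ∀ a, predictive obs με a = c • predictive obs ν a + d • obs (M, a) := fun a => by
    rw [hμε, predictive_add_smul, predictive_dirac]
  have hloss : ∀ a, ∫⁻ o, negLog (decisionPosterior obs με a o {b}) ∂(obs (M, a))
      = ENNReal.ofReal (-∫ o, Real.log ((decisionPosterior obs με a o).real {b}) ∂(obs (M, a))) := by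
    intro a
    rw [← integral_neg, ofReal_integral_eq_lintegral_ofReal
      (f := fun o => -Real.log ((decisionPosterior obs με a o).real {b})) (key a).1.neg]
    · refine lintegral_congr_ae ?_
      filter_upwards [(key a).2.1] with o ho
      exact negLog_eq_ofReal ho (measure_ne_top _ _)
    · refine Eventually.of_forall fun o => ?_
      simpa using Real.log_nonpos measureReal_nonneg (measureReal_le_one (s := {b}))
  have hneg : ∀ a, 0 ≤ -∫ o, Real.log ((decisionPosterior obs με a o).real {b}) ∂(obs (M, a)) := by
    intro a
    rw [← integral_neg]
    refine integral_nonneg fun o => ?_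
    simpa using Real.log_nonpos measureReal_nonneg (measureReal_le_one (s := {b}))
  have hV : ∫⁻ a, ∫⁻ o, negLog (decisionPosterior obs με a o {b}) ∂(obs (M, a)) ∂p
      = ∑ a, ENNReal.ofReal (p.real {a}
        * -∫ o, Real.log ((decisionPosterior obs με a o).real {b}) ∂(obs (M, a))) := by
    rw [lintegral_fintype]
    refine Finset.sum_congr rfl fun a _ => ?_
    rw [hloss, ENNReal.ofReal_mul measureReal_nonneg, ofReal_measureReal, mul_comm]
  have hV' : (∫⁻ a, ∫⁻ o, negLog (decisionPosterior obs με a o {b}) ∂(obs (M, a)) ∂p).toReal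
      = ∑ a, p.real {a}
        * -∫ o, Real.log ((decisionPosterior obs με a o).real {b}) ∂(obs (M, a)) := by
    rw [hV, ← ENNReal.ofReal_sum_of_nonneg fun a _ => mul_nonneg measureReal_nonneg (hneg a),
      ENNReal.toReal_ofReal (Finset.sum_nonneg fun a _ => mul_nonneg measureReal_nonneg (hneg a))]
  refine ⟨?_, by rw [hV]; exact ENNReal.sum_ne_top.2 fun _ _ => ENNReal.ofReal_ne_top⟩
  rw [hV', AIR_eq_sum obs hf hC η q p hq ν, AIR_eq_sum obs hf hC η q p hq με]
  have hp1 := sum_measureReal_singleton_eq_one p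
  -- As `p` has total mass one, the terms free of `a` can be moved under the sum, which reduces the
  -- claim to one inequality per decision.
  have hlin : (f M b - ∑ a, p.real {a} * f M a + Real.log (q.real {b}) / η)
      + 1 / η * ∑ a, p.real {a}
        * -∫ o, Real.log ((decisionPosterior obs με a o).real {b}) ∂(obs (M, a))
      = ∑ a, p.real {a} * (f M b - f M a - 1 / η * ∫ o,
        (Real.log ((decisionPosterior obs με a o).real {b}) - Real.log (q.real {b})) ∂(obs (M, a))) := by
    have e : ∀ a, p.real {a} * (f M b - f M a - 1 / η * ∫ o,
        (Real.log ((decisionPosterior obs με a o).real {b}) - Real.log (q.real {b})) ∂(obs (M, a)))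
        = p.real {a} * (f M b + Real.log (q.real {b}) / η) - p.real {a} * f M a
          + 1 / η * (p.real {a}
            * -∫ o, Real.log ((decisionPosterior obs με a o).real {b}) ∂(obs (M, a))) := by
      intro a
      rw [integral_sub (key a).1 (integrable_const _)]
      simp only [integral_const, probReal_univ, one_smul]
      ring
    rw [Finset.sum_congr rfl fun a _ => e a, Finset.sum_add_distrib, Finset.sum_sub_distrib,
      ← Finset.sum_mul, hp1, Finset.mul_sum]
    ring
  rw [hlin, Finset.mul_sum, Finset.mul_sum, ← Finset.sum_add_distrib]
  refine Finset.sum_le_sum fun a _ => ?_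
  have mg : Measurable fun x : 𝓜 × A => f x.1 x.2 - f x.1 a :=
    (measurable_uncurry_reward hf).sub ((hf a).comp measurable_fst)
  have bg : ∀ x : 𝓜 × A, |f x.1 x.2 - f x.1 a| ≤ C + C := fun x =>
    (abs_sub _ _).trans (add_le_add (hC _ _) (hC _ _))
  have hg : ∫ x : 𝓜 × A, (f x.1 x.2 - f x.1 a) ∂με
      = c * ∫ x : 𝓜 × A, (f x.1 x.2 - f x.1 a) ∂ν + d * (f M b - f M a) := by
    rw [hμε, integral_add_measure (integrable_of_bounded mg _ bg)
      (integrable_of_bounded mg _ bg), integral_smul_nnreal_measure,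
      integral_smul_nnreal_measure, integral_dirac' _ _ mg.stronglyMeasurable]
    simp [NNReal.smul_def]
  rw [hg, epred]
  have hk := mul_le_mul_of_nonneg_left (key a).2.2 (one_div_pos.2 hη).le
  have := mul_le_mul_of_nonneg_left hk (measureReal_nonneg (μ := p) (s := {a}))
  linarith

/-- Lower bound on the directional derivative towards a point mass, by the lower limit of the
expected log losses of the perturbed posteriors. -/
lemma le_AIR_add_firstOrderGap (hf : ∀ a, Measurable fun M => f M a) (hC : ∀ M a, |f M a| ≤ C)
    {η : ℝ} (hη : 0 < η) (q p : Measure A) [IsProbabilityMeasure q] [IsProbabilityMeasure p]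
    (hq : ∀ b, q {b} ≠ 0) (ν : Measure (𝓜 × A)) [IsProbabilityMeasure ν] (M : 𝓜) (b : A)
    {v : ℝ≥0∞} (hv : v ≤ liminf (fun ε : ℝ => ∫⁻ a, ∫⁻ o, negLog
      (decisionPosterior obs ((1 - ε).toNNReal • ν + ε.toNNReal • Measure.dirac (M, b)) a o {b})
        ∂(obs (M, a)) ∂p) (𝓝[>] 0)) :
    ((f M b - ∑ a, p.real {a} * f M a + Real.log (q.real {b}) / η : ℝ) : EReal)
        + ((ENNReal.ofReal (1 / η) * v : ℝ≥0∞) : EReal)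
      ≤ (AIR obs f η q p ν : EReal) + firstOrderGap obs f η q p ν := by
  set V : ℝ → ℝ≥0∞ := fun ε => ∫⁻ a, ∫⁻ o, negLog
      (decisionPosterior obs ((1 - ε).toNNReal • ν + ε.toNNReal • Measure.dirac (M, b)) a o {b})
        ∂(obs (M, a)) ∂p with hV
  set K := f M b - ∑ a, p.real {a} * f M a + Real.log (q.real {b}) / η with hK
  set I := AIR obs f η q p ν with hI
  -- `H` sends the log loss of the perturbed posterior to a lower bound of the difference quotient;
  -- being monotone and continuous, it commutes with the lower limit.
  set H : ℝ≥0∞ → EReal := fun v => ((K - I : ℝ) : EReal)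
    + ((ENNReal.ofReal (1 / η) * v : ℝ≥0∞) : EReal) with hH
  have Hmono : Monotone H := fun x y hxy =>
    add_le_add_right (EReal.coe_ennreal_le_coe_ennreal_iff.2 (mul_le_mul_right hxy _)) _
  have Hcont : Continuous H := by
    refine continuous_iff_continuousAt.2 fun x => ?_
    have h1 : ContinuousAt (fun v : ℝ≥0∞ => ((ENNReal.ofReal (1 / η) * v : ℝ≥0∞) : EReal)) x :=
      (continuous_coe_ennreal_ereal.comp (ENNReal.continuous_const_mul ENNReal.ofReal_ne_top)).continuousAt
    have h2 : ContinuousAt (fun p : EReal × EReal => p.1 + p.2)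
        (((K - I : ℝ) : EReal), ((ENNReal.ofReal (1 / η) * x : ℝ≥0∞) : EReal)) :=
      EReal.continuousAt_add (Or.inl (EReal.coe_ne_top _)) (Or.inl (EReal.coe_ne_bot _))
    exact ContinuousAt.comp (f := fun v : ℝ≥0∞ =>
      (((K - I : ℝ) : EReal), ((ENNReal.ofReal (1 / η) * v : ℝ≥0∞) : EReal))) h2
      (continuousAt_const.prodMk h1)
  have hderiv : H v ≤ airDeriv obs f η q p ν (Measure.dirac (M, b)) := by
    refine (Hmono hv).trans ?_
    rw [Hmono.map_liminf_of_continuousAt _ Hcont.continuousAt]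
    refine liminf_le_liminf ?_
    filter_upwards [self_mem_nhdsWithin, nhdsWithin_le_nhds (eventually_lt_nhds one_pos)] with ε h0 h1
    have h0' : (0 : ℝ) < ε := h0
    have hε : ((ε.toNNReal : ℝ≥0) : ℝ) = ε := Real.coe_toNNReal _ h0'.le
    have hε' : (((1 - ε).toNNReal : ℝ≥0) : ℝ) = 1 - ε := Real.coe_toNNReal _ (by linarith)
    obtain ⟨hle, hfin⟩ := le_AIR_mixture obs hf hC hη q p hq ν M b (c := (1 - ε).toNNReal)
      (d := ε.toNNReal) (by simpa using h0') (by ext; push_cast [hε, hε']; ring)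
    change V ε ≠ ∞ at hfin
    change _ + _ * (_ + _ * (V ε).toReal) ≤ _ at hle
    rw [hε, hε', ← hK, ← hI] at hle
    have e : H (V ε) = ((K - I + 1 / η * (V ε).toReal : ℝ) : EReal) := by
      simp only [hH]
      rw [← ENNReal.ofReal_toReal hfin, ← ENNReal.ofReal_mul (by positivity),
        EReal.coe_ennreal_ofReal, max_eq_left (by positivity), ENNReal.toReal_ofReal (by positivity)]
      norm_cast
    -- With `c = 1 - ε` and `d = ε`, the bound minus `I` is exactly `ε` times `K - I + V ε / η`.
    rw [Function.comp_apply, e, EReal.coe_le_coe_iff, le_div_iff₀ h0']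
    linarith
  have hgap : H v ≤ firstOrderGap obs f η q p ν :=
    hderiv.trans (le_iSup (fun νs : ProbabilityMeasure (𝓜 × A) =>
      airDeriv obs f η q p ν (νs : Measure (𝓜 × A))) ⟨Measure.dirac (M, b), inferInstance⟩)
  refine le_trans (le_of_eq ?_) (add_le_add_right hgap _)
  rw [hH, ← add_assoc, ← EReal.coe_add, add_sub_cancel]

/-- Fatou's lemma is used twice, over observations and over decisions; decisions of `p`-mass zero do
not contribute, so domination is needed only where `p` charges. -/
lemma le_AIR_add_firstOrderGap_of_ac (hf : ∀ a, Measurable fun M => f M a)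
    (hC : ∀ M a, |f M a| ≤ C)
    {η : ℝ} (hη : 0 < η) (q p : Measure A) [IsProbabilityMeasure q] [IsProbabilityMeasure p]
    (hq : ∀ b, q {b} ≠ 0) (ν : Measure (𝓜 × A)) [IsProbabilityMeasure ν] (M : 𝓜) (b : A)
    (hac : ∀ a, p {a} ≠ 0 → obs (M, a) ≪ predictive obs ν a) :
    ((f M b - ∑ a, p.real {a} * f M a + Real.log (q.real {b}) / η : ℝ) : EReal)
        + ((ENNReal.ofReal (1 / η) * ∫⁻ a, ∫⁻ o, negLog (decisionPosterior obs ν a o {b})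
          ∂(obs (M, a)) ∂p : ℝ≥0∞) : EReal)
      ≤ (AIR obs f η q p ν : EReal) + firstOrderGap obs f η q p ν := by
  classical
  refine le_AIR_add_firstOrderGap obs hf hC hη q p hq ν M b ?_
  refine le_trans (lintegral_mono_ae ?_)
    (lintegral_liminf_le' fun ε => (measurable_of_countable _).aemeasurable)
  refine ae_iff_of_countable.2 fun a ha => ?_
  refine lintegral_negLog_le_liminf (hac a ha) (measurable_decisionPosterior obs ν a b)
    (fun ε => measurable_decisionPosterior obs _ a b) fun ε _ _ => ?_
  rw [withDensity_decisionPosterior_mixture, if_pos rfl]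

end Gap

/-! ### Extended expectations and telescoping of log losses. -/

section ExtendedExpectation

variable {Ω : Type*} [MeasurableSpace Ω] {P : Measure Ω}

/-- Only monotonicity of the lower integral is used, on positive and negative parts, so `X` need not
be measurable. -/
lemma integral_le_extExpectation {Y : Ω → ℝ} (hY : Integrable Y P) {X : Ω → EReal}
    (h : ∀ᵐ ω ∂P, (Y ω : EReal) ≤ X ω) : ((∫ ω, Y ω ∂P : ℝ) : EReal) ≤ extExpectation P X := by
  have hpos : ∫⁻ ω, ENNReal.ofReal (Y ω) ∂P ≠ ∞ := hY.lintegral_lt_top.ne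
  have hneg : ∫⁻ ω, ENNReal.ofReal (-Y ω) ∂P ≠ ∞ := hY.neg.lintegral_lt_top.ne
  rw [integral_eq_lintegral_pos_part_sub_lintegral_neg_part hY, EReal.coe_sub,
    EReal.coe_ennreal_toReal hpos, EReal.coe_ennreal_toReal hneg]
  refine EReal.sub_le_sub ?_ ?_
  · refine EReal.coe_ennreal_le_coe_ennreal_iff.2 (lintegral_mono_ae ?_)
    filter_upwards [h] with ω hω
    exact EReal.toENNReal_le_toENNReal hω
  · refine EReal.coe_ennreal_le_coe_ennreal_iff.2 (lintegral_mono_ae ?_)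
    filter_upwards [h] with ω hω
    rw [← EReal.real_coe_toENNReal, EReal.coe_neg]
    exact EReal.toENNReal_le_toENNReal (EReal.neg_le_neg_iff.2 hω)

lemma ereal_coe_sum {ι : Type*} (s : Finset ι) (g : ι → ℝ) :
    ((∑ i ∈ s, g i : ℝ) : EReal) = ∑ i ∈ s, (g i : EReal) := by
  classical
  induction s using Finset.induction_on with
  | empty => simp
  | insert i s hi ih => rw [Finset.sum_insert hi, Finset.sum_insert hi, EReal.coe_add, ih]

/-- Isolates the nonnegative term `v`, so that its integral can be bounded through the positive part
of `x`. -/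
lemma le_toENNReal_add_of_ereal_le {r k K : ℝ} {v : ℝ≥0∞} {x : EReal}
    (h : (r : EReal) + v + k ≤ x + K) :
    v ≤ x.toENNReal + ENNReal.ofReal (K - k - r) := by
  induction x with
  | bot =>
    exfalso
    rw [EReal.bot_add, le_bot_iff] at h
    have hv : (v : EReal) ≠ ⊥ := EReal.coe_ennreal_ne_bot v
    simp [EReal.add_eq_bot_iff, hv] at h
  | top => simp
  | coe x =>
    by_cases hv : v = ∞
    · subst hv
      exfalso
      rw [EReal.coe_ennreal_top, EReal.coe_add_top, EReal.top_add_coe, ← EReal.coe_add, top_le_iff]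
        at h
      exact EReal.coe_ne_top _ h
    · lift v to ℝ≥0 using hv
      have h' : r + (v : ℝ) + k ≤ x + K := by
        rw [show (((v : ℝ≥0∞)) : EReal) = ((v : ℝ) : EReal) from rfl] at h
        exact_mod_cast h
      rw [EReal.real_coe_toENNReal]
      refine le_trans ?_ ENNReal.ofReal_add_le
      rw [← ENNReal.ofReal_coe_nnreal]
      exact ENNReal.ofReal_le_ofReal (by linarith)

/-- Telescoping of log losses: `U t` is the current log loss, `V t` the conditional expectation of
the next one.  The variables `X t` need not be measurable. -/
lemma sum_integral_le_add_extExpectation [IsProbabilityMeasure P] {T : ℕ} {X : ℕ → Ω → EReal}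
    {G : ℕ → Ω → ℝ} {U V : ℕ → Ω → ℝ≥0∞} {η C K L : ℝ} (hη : 0 < η) (hL : 0 ≤ L)
    (hG : ∀ t < T, Measurable (G t)) (hGC : ∀ t ω, |G t ω| ≤ C)
    (hU : ∀ t < T, Measurable (U t)) (hV : ∀ t, t + 1 < T → Measurable (V t))
    (hUfin : ∀ t < T, ∀ᵐ ω ∂P, U t ω ≠ ∞)
    (hU0 : ∫⁻ ω, U 0 ω ∂P ≤ ENNReal.ofReal L)
    (hUV : ∀ t, t + 1 < T → ∫⁻ ω, V t ω ∂P = ∫⁻ ω, U (t + 1) ω ∂P)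
    (hX : ∀ t < T, ∀ᵐ ω ∂P, ((G t ω - (U t ω).toReal / η : ℝ) : EReal) ≤ X t ω)
    (hXV : ∀ t, t + 1 < T → ∀ᵐ ω ∂P, ((G t ω - (U t ω).toReal / η : ℝ) : EReal)
      + ((ENNReal.ofReal (1 / η) * V t ω : ℝ≥0∞) : EReal) ≤ X t ω)
    (hlow : ∀ t < T, ∀ᵐ ω ∂P, ((-K : ℝ) : EReal) ≤ X t ω) :
    ((∑ t ∈ Finset.range T, ∫ ω, G t ω ∂P : ℝ) : EReal)
      ≤ ((L / η : ℝ) : EReal) + extExpectation P (fun ω => ∑ t ∈ Finset.range T, X t ω) := by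
  have hlow' : ∀ᵐ ω ∂P, ∀ t < T, ((-K : ℝ) : EReal) ≤ X t ω := by
    refine ae_all_iff.2 fun t => ?_
    by_cases ht : t < T
    · filter_upwards [hlow t ht] with ω h _ using h
    · exact Eventually.of_forall fun _ h => absurd h ht
  have hneg : ∫⁻ ω, (-∑ t ∈ Finset.range T, X t ω).toENNReal ∂P ≠ ∞ := by
    refine ne_top_of_le_ne_top (ENNReal.ofReal_ne_top (r := T * K)) ?_
    calc ∫⁻ ω, (-∑ t ∈ Finset.range T, X t ω).toENNReal ∂P
        ≤ ∫⁻ _, ENNReal.ofReal (T * K) ∂P := by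
          refine lintegral_mono_ae ?_
          filter_upwards [hlow'] with ω hω
          rw [← EReal.real_coe_toENNReal]
          refine EReal.toENNReal_le_toENNReal (EReal.neg_le.1 ?_)
          calc -(((T * K : ℝ)) : EReal) = ∑ t ∈ Finset.range T, ((-K : ℝ) : EReal) := by
                rw [← ereal_coe_sum, ← EReal.coe_neg]
                simp
            _ ≤ _ := Finset.sum_le_sum fun t ht => hω t (Finset.mem_range.1 ht)
      _ = _ := by simp
  -- The negative part has finite mean, so an infinite positive part makes the right-hand side `⊤`.
  by_cases hpos : ∫⁻ ω, (∑ t ∈ Finset.range T, X t ω).toENNReal ∂P = ∞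
  · have : extExpectation P (fun ω => ∑ t ∈ Finset.range T, X t ω) = ⊤ := by
      rw [extExpectation, hpos, EReal.coe_ennreal_top, sub_eq_add_neg, EReal.top_add_of_ne_bot]
      rw [Ne, EReal.neg_eq_bot_iff]
      simpa using hneg
    rw [this, EReal.coe_add_top]
    exact le_top
  -- Integrability propagates forward: `V t / η` is at most the positive part of the total, plus a
  -- constant, plus `U t / η`, and `V t` has the same mean as `U (t + 1)`.
  have hUint : ∀ t < T, ∫⁻ ω, U t ω ∂P ≠ ∞ := by
    intro t
    induction t with
    | zero => exact fun _ => ne_top_of_le_ne_top ENNReal.ofReal_ne_top hU0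
    | succ t ih =>
      intro ht
      have ihU := ih (by omega)
      rw [← hUV t ht]
      have hle : ∀ᵐ ω ∂P, ENNReal.ofReal (1 / η) * V t ω
          ≤ (∑ s ∈ Finset.range T, X s ω).toENNReal
            + (ENNReal.ofReal (|T * K - K| + C) + ENNReal.ofReal (1 / η) * U t ω) := by
        filter_upwards [hXV t ht, hlow', hUfin t (by omega)] with ω h1 h2 h3
        -- After adding `K` all summands are nonnegative, so one of them is at most their sum.
        have hsum : X t ω + (K : EReal)
            ≤ (∑ s ∈ Finset.range T, X s ω) + ((T * K : ℝ) : EReal) := by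
          have e : ((T * K : ℝ) : EReal) = ∑ s ∈ Finset.range T, (K : EReal) := by
            rw [← ereal_coe_sum]; simp
          rw [e, ← Finset.sum_add_distrib]
          refine Finset.single_le_sum (f := fun s => X s ω + (K : EReal)) (fun s hs => ?_)
            (Finset.mem_range.2 (by omega))
          calc (0 : EReal) = ((-K : ℝ) : EReal) + (K : EReal) := by
                rw [← EReal.coe_add]; simp
            _ ≤ _ := add_le_add_left (h2 s (Finset.mem_range.1 hs)) _
        refine (le_toENNReal_add_of_ereal_le ((add_le_add_left h1 _).trans hsum)).trans ?_
        gcongr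
        have hUr : ENNReal.ofReal (1 / η) * U t ω
            = ENNReal.ofReal ((U t ω).toReal / η) := by
          conv_lhs => rw [← ENNReal.ofReal_toReal h3]
          rw [← ENNReal.ofReal_mul (by positivity)]
          congr 1; ring
        rw [hUr]
        refine le_trans (ENNReal.ofReal_le_ofReal ?_) ENNReal.ofReal_add_le
        have := (abs_le.1 (hGC t ω)).1
        have := le_abs_self (T * K - K)
        linarith
      have hfin : ∫⁻ ω, ENNReal.ofReal (1 / η) * V t ω ∂P ≠ ∞ := by
        refine ne_top_of_le_ne_top ?_ (lintegral_mono_ae hle)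
        have mU := hU t (by omega)
        rw [lintegral_add_right _ (by fun_prop), lintegral_add_right _ (by fun_prop),
          lintegral_const_mul _ mU]
        simp only [lintegral_const, measure_univ, mul_one]
        exact ENNReal.add_ne_top.2 ⟨hpos, ENNReal.add_ne_top.2
          ⟨ENNReal.ofReal_ne_top, ENNReal.mul_ne_top ENNReal.ofReal_ne_top ihU⟩⟩
      rw [lintegral_const_mul _ (hV t ht)] at hfin
      intro htop
      rw [htop, ENNReal.mul_top] at hfin
      · exact hfin rfl
      · simpa using hη
  have iU : ∀ t < T, Integrable (fun ω => (U t ω).toReal) P := fun t ht =>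
    integrable_toReal_of_lintegral_ne_top (hU t ht).aemeasurable (hUint t ht)
  have hVint : ∀ t, t + 1 < T → ∫⁻ ω, V t ω ∂P ≠ ∞ := fun t ht => by
    rw [hUV t ht]; exact hUint _ ht
  have iV : ∀ t, t + 1 < T → Integrable (fun ω => (V t ω).toReal) P := fun t ht =>
    integrable_toReal_of_lintegral_ne_top (hV t ht).aemeasurable (hVint t ht)
  have eUV : ∀ t, t + 1 < T → ∫ ω, (V t ω).toReal ∂P = ∫ ω, (U (t + 1) ω).toReal ∂P := by
    intro t ht
    rw [integral_toReal (hV t ht).aemeasurable (ae_lt_top (hV t ht) (hVint t ht)),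
      integral_toReal (hU _ ht).aemeasurable (ae_lt_top (hU _ ht) (hUint _ ht)), hUV t ht]
  have iG : ∀ t < T, Integrable (G t) P := fun t ht => integrable_of_bounded (hG t ht) C (hGC t)
  -- An integrable real minorant of `X t`; the final round carries no next log loss.
  set Y : ℕ → Ω → ℝ := fun t ω => G t ω - (U t ω).toReal / η
    + if t + 1 < T then (V t ω).toReal / η else 0 with hY
  have iY : ∀ t < T, Integrable (Y t) P := fun t ht => by
    refine ((iG t ht).sub ((iU t ht).div_const η)).add ?_
    by_cases ht' : t + 1 < T
    · simpa [ht'] using (iV t ht').div_const η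
    · simp [ht']
  have hYX : ∀ᵐ ω ∂P, ∀ t < T, (Y t ω : EReal) ≤ X t ω := by
    refine ae_all_iff.2 fun t => ?_
    by_cases ht : t < T
    swap
    · exact Eventually.of_forall fun _ h => absurd h ht
    by_cases ht' : t + 1 < T
    · filter_upwards [hXV t ht', ae_lt_top (hV t ht') (hVint t ht')] with ω h1 h2 _
      refine le_trans (le_of_eq ?_) h1
      simp only [hY, if_pos ht']
      rw [EReal.coe_add]
      congr 1
      conv_rhs => rw [← ENNReal.ofReal_toReal h2.ne]
      rw [← ENNReal.ofReal_mul (by positivity), EReal.coe_ennreal_ofReal,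
        max_eq_left (by positivity)]
      congr 1; ring
    · filter_upwards [hX t ht] with ω h1 _
      simpa [hY, ht'] using h1
  have hmain := integral_le_extExpectation (P := P) (Y := fun ω => ∑ t ∈ Finset.range T, Y t ω)
    (X := fun ω => ∑ t ∈ Finset.range T, X t ω)
    (integrable_finsetSum _ fun t ht => iY t (Finset.mem_range.1 ht)) (by
      filter_upwards [hYX] with ω hω
      rw [ereal_coe_sum]
      exact Finset.sum_le_sum fun t ht => hω t (Finset.mem_range.1 ht))
  refine le_trans ?_ (add_le_add_right hmain _)
  rw [← EReal.coe_add, EReal.coe_le_coe_iff,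
    integral_finsetSum _ fun t ht => iY t (Finset.mem_range.1 ht)]
  have eY : ∀ t ∈ Finset.range T, ∫ ω, Y t ω ∂P = ∫ ω, G t ω ∂P
      - (∫ ω, (U t ω).toReal ∂P) / η
      + (if t + 1 < T then (∫ ω, (U (t + 1) ω).toReal ∂P) / η else 0) := by
    intro t ht
    have ht := Finset.mem_range.1 ht
    have e1 : ∫ ω, (G t ω - (U t ω).toReal / η) ∂P
        = ∫ ω, G t ω ∂P - (∫ ω, (U t ω).toReal ∂P) / η := by
      rw [integral_sub (iG t ht) ((iU t ht).div_const η), integral_div]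
    by_cases ht' : t + 1 < T
    · simp only [hY, if_pos ht']
      rw [integral_add (f := fun ω => G t ω - (U t ω).toReal / η)
        ((iG t ht).sub ((iU t ht).div_const η)) ((iV t ht').div_const η), e1,
        integral_div, eUV t ht']
    · simp only [hY, if_neg ht', add_zero]
      exact e1
  rw [Finset.sum_congr rfl eY, Finset.sum_add_distrib, Finset.sum_sub_distrib]
  have hU0' : (∫ ω, (U 0 ω).toReal ∂P) / η ≤ L / η ∨ T = 0 := by
    rcases Nat.eq_zero_or_pos T with h | h
    · exact Or.inr h
    left
    gcongr
    rw [integral_toReal (hU 0 h).aemeasurable (ae_lt_top (hU 0 h) (hUint 0 h))]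
    exact ENNReal.toReal_le_of_le_ofReal hL hU0
  cases T with
  | zero => simpa using div_nonneg hL hη.le
  | succ n =>
    have h0 := hU0'.resolve_right (by omega)
    -- Dropping the empty last term of one sum and splitting off the first of the other leaves
    -- matching sums; only `U 0` survives.
    rw [Finset.sum_range_succ (fun t => if t + 1 < n + 1 then
        (∫ ω, (U (t + 1) ω).toReal ∂P) / η else 0), if_neg (lt_irrefl _), add_zero,
      Finset.sum_range_succ' (fun t => (∫ ω, (U t ω).toReal ∂P) / η),
      Finset.sum_congr rfl fun t ht => if_pos (Nat.succ_lt_succ (Finset.mem_range.1 ht))]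
    linarith

end ExtendedExpectation

/-! ### One-step conditional laws along a play. -/

section Play

variable {Ω 𝓜 A 𝒪 : Type*} [MeasurableSpace Ω] [MeasurableSpace 𝓜] [MeasurableSpace A]
  [MeasurableSpace 𝒪]

lemma history_succ {Ω A 𝒪 : Type*} (dec : ℕ → Ω → A) (out : ℕ → Ω → 𝒪) (t : ℕ) (ω : Ω) :
    history dec out (t + 1) ω
      = Fin.snoc (α := fun _ => A × 𝒪) (history dec out t ω) (dec t ω, out t ω) := by
  funext i
  refine Fin.lastCases ?_ (fun j => ?_) i
  · simp [history]
  · simp [history]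

lemma measurable_history_snoc (t : ℕ) :
    Measurable fun z : History A 𝒪 t × (A × 𝒪) =>
      (Fin.snoc (α := fun _ => A × 𝒪) z.1 z.2 : History A 𝒪 (t + 1)) := by
  refine measurable_pi_lambda _ fun i => ?_
  refine Fin.lastCases ?_ (fun j => ?_) i
  · simpa using measurable_snd
  · simpa [Function.comp_def] using
      (measurable_pi_apply (X := fun _ : Fin t => A × 𝒪) j).comp measurable_fst

variable {obs : Kernel (𝓜 × A) 𝒪} {T : ℕ}
  {p : (t : ℕ) → Kernel (History A 𝒪 t) A} {P : Measure Ω}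
  {model : ℕ → Ω → 𝓜} {dec : ℕ → Ω → A} {out : ℕ → Ω → 𝒪}

lemma IsPlay.measurable_history (h : IsPlay obs T p P model dec out) {t : ℕ} (ht : t ≤ T) :
    Measurable (history dec out t) :=
  measurable_pi_lambda _ fun i =>
    (h.measurable_dec i (i.2.trans_le ht)).prodMk (h.measurable_out i (i.2.trans_le ht))

lemma IsPlay.measurable_history_model (h : IsPlay obs T p P model dec out) {t : ℕ} (ht : t < T) :
    Measurable fun ω => (history dec out t ω, model t ω) :=
  (h.measurable_history ht.le).prodMk (h.measurable_model t ht)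

instance isMarkovKernel_roundKernel [IsMarkovKernel obs] {t : ℕ} (p : Kernel (History A 𝒪 t) A)
    [IsMarkovKernel p] : IsMarkovKernel (roundKernel obs p) := by
  unfold roundKernel; infer_instance

lemma lintegral_roundKernel [IsMarkovKernel obs] {t : ℕ} (p : Kernel (History A 𝒪 t) A)
    [IsMarkovKernel p] (h : History A 𝒪 t) (M : 𝓜) {g : A × 𝒪 → ℝ≥0∞} (hg : Measurable g) :
    ∫⁻ y, g y ∂(roundKernel obs p (h, M)) = ∫⁻ a, ∫⁻ o, g (a, o) ∂(obs (M, a)) ∂(p h) := by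
  rw [roundKernel, Kernel.lintegral_compProd _ _ _ hg]
  simp only [Kernel.comap_apply]

/-- The expectation of a function of the next history is the expectation of its conditional
expectation. -/
lemma IsPlay.lintegral_history_succ [IsFiniteMeasure P] [IsMarkovKernel obs]
    [∀ t, IsMarkovKernel (p t)]
    (h : IsPlay obs T p P model dec out) {t : ℕ} (ht : t < T) {g : History A 𝒪 (t + 1) → ℝ≥0∞}
    (hg : Measurable g) :
    Measurable (fun ω => ∫⁻ a, ∫⁻ o, g (Fin.snoc (α := fun _ => A × 𝒪) (history dec out t ω) (a, o))
        ∂(obs (model t ω, a)) ∂(p t (history dec out t ω))) ∧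
    ∫⁻ ω, ∫⁻ a, ∫⁻ o, g (Fin.snoc (α := fun _ => A × 𝒪) (history dec out t ω) (a, o))
        ∂(obs (model t ω, a)) ∂(p t (history dec out t ω)) ∂P
      = ∫⁻ ω, g (history dec out (t + 1) ω) ∂P := by
  set F : (History A 𝒪 t × 𝓜) × (A × 𝒪) → ℝ≥0∞ := fun z =>
    g (Fin.snoc (α := fun _ => A × 𝒪) z.1.1 z.2) with hF
  have mF : Measurable F := hg.comp ((measurable_history_snoc t).comp
    ((measurable_fst.comp measurable_fst).prodMk measurable_snd))
  have e : ∀ x : History A 𝒪 t × 𝓜,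
      ∫⁻ a, ∫⁻ o, g (Fin.snoc (α := fun _ => A × 𝒪) x.1 (a, o)) ∂(obs (x.2, a)) ∂(p t x.1)
        = ∫⁻ y, F (x, y) ∂(roundKernel obs (p t) x) := fun x =>
    (lintegral_roundKernel (p t) x.1 x.2 (mF.comp measurable_prodMk_left)).symm
  have mI : Measurable fun x => ∫⁻ y, F (x, y) ∂(roundKernel obs (p t) x) :=
    Measurable.lintegral_kernel_prod_right' mF
  have mhm := h.measurable_history_model ht
  have e' : ∀ ω, ∫⁻ a, ∫⁻ o, g (Fin.snoc (α := fun _ => A × 𝒪) (history dec out t ω) (a, o))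
        ∂(obs (model t ω, a)) ∂(p t (history dec out t ω))
      = ∫⁻ y, F ((history dec out t ω, model t ω), y)
        ∂(roundKernel obs (p t) (history dec out t ω, model t ω)) := fun ω => e (_, _)
  simp only [e']
  refine ⟨mI.comp mhm, ?_⟩
  rw [← lintegral_map mI mhm, ← Measure.lintegral_compProd mF, ← h.law_round t ht,
    lintegral_map mF (mhm.prodMk ((h.measurable_dec t ht).prodMk (h.measurable_out t ht)))]
  simp only [hF, history_succ]

/-- The per-round bound involves the mean reward under `p t`, the regret the reward of the decision
played; conditioning on history and model identifies their expectations. -/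
lemma IsPlay.integral_decision [IsFiniteMeasure P] [IsMarkovKernel obs]
    [∀ t, IsMarkovKernel (p t)] [Fintype A] [DiscreteMeasurableSpace A]
    (h : IsPlay obs T p P model dec out) {t : ℕ} (ht : t < T) {f : 𝓜 → A → ℝ}
    (hf : ∀ a, Measurable fun M => f M a) {C : ℝ} (hC : ∀ M a, |f M a| ≤ C) :
    ∫ ω, ∑ a, (p t (history dec out t ω)).real {a} * f (model t ω) a ∂P
      = ∫ ω, f (model t ω) (dec t ω) ∂P := by
  set F : (History A 𝒪 t × 𝓜) × (A × 𝒪) → ℝ := fun z => f z.1.2 z.2.1 with hF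
  have mF : Measurable F := (measurable_uncurry_reward hf).comp
    ((measurable_snd.comp measurable_fst).prodMk (measurable_fst.comp measurable_snd))
  have mhm := h.measurable_history_model ht
  have mdo := (h.measurable_dec t ht).prodMk (h.measurable_out t ht)
  have iF : ∀ (ρ : Measure ((History A 𝒪 t × 𝓜) × (A × 𝒪))) [IsFiniteMeasure ρ], Integrable F ρ :=
    fun ρ _ => integrable_of_bounded mF C fun z => hC _ _
  have e1 : ∫ ω, f (model t ω) (dec t ω) ∂P
      = ∫ z, F z ∂(P.map fun ω => ((history dec out t ω, model t ω), (dec t ω, out t ω))) := by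
    rw [integral_map (mhm.prodMk mdo).aemeasurable mF.aestronglyMeasurable]
  rw [e1, h.law_round t ht, Measure.integral_compProd (iF _)]
  have e2 : ∀ x : History A 𝒪 t × 𝓜, ∫ y, F (x, y) ∂(roundKernel obs (p t) x)
      = ∑ a, (p t x.1).real {a} * f x.2 a := by
    intro x
    rw [roundKernel, ProbabilityTheory.integral_compProd]
    · simp only [hF, integral_const, probReal_univ, one_smul, Kernel.comap_apply]
      rw [integral_fintype Integrable.of_finite]
      simp
    · exact integrable_of_bounded (mF.comp measurable_prodMk_left) C fun z => hC _ _
  simp only [e2]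
  rw [integral_map mhm.aemeasurable]
  refine Measurable.aestronglyMeasurable (Finset.measurable_sum _ fun a _ => ?_)
  exact (((Kernel.measurable_coe (p t) (measurableSet_singleton a)).comp
    measurable_fst).ennreal_toReal).mul ((hf a).comp measurable_snd)

end Play

/-! ### Assembly of the regret bound. -/

lemma toReal_negLog {A : Type*} [MeasurableSpace A] {r : Measure A} [IsProbabilityMeasure r] {b : A}
    (h : r {b} ≠ 0) : (negLog (r {b})).toReal = -Real.log (r.real {b}) := by
  rw [negLog_eq_ofReal h (measure_ne_top _ _), ENNReal.toReal_ofReal]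
  · rfl
  · exact neg_nonneg.2 (Real.log_nonpos measureReal_nonneg measureReal_le_one)

lemma exists_inv_card_le_measureReal {A : Type*} [Fintype A] [Nonempty A] [MeasurableSpace A]
    [MeasurableSingletonClass A] (r : Measure A) [IsProbabilityMeasure r] :
    ∃ b, (Fintype.card A : ℝ)⁻¹ ≤ r.real {b} := by
  by_contra! h
  have h1 : ∑ b, r.real {b} = 1 := by simp
  have h2 : ∑ b, r.real {b} < ∑ _b : A, (Fintype.card A : ℝ)⁻¹ :=
    Finset.sum_lt_sum_of_nonempty Finset.univ_nonempty fun b _ => h b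
  rw [h1] at h2
  simp at h2

end AlgorithmicBeliefs

end

open AlgorithmicBeliefs in
theorem theorem3p4
    {Ω 𝓜 A 𝒪 : Type*}
    -- the compact model class
    [MetricSpace 𝓜] [CompactSpace 𝓜] [Nonempty 𝓜] [MeasurableSpace 𝓜] [BorelSpace 𝓜]
    -- the finite decision space
    [Fintype A] [Nonempty A] [MeasurableSpace A] [DiscreteMeasurableSpace A]
    -- the observation space
    [MeasurableSpace 𝒪]
    (obs : Kernel (𝓜 × A) 𝒪) [IsMarkovKernel obs]
    (f : 𝓜 → A → ℝ) (hf : ∀ a, Measurable fun M => f M a) (hfb : ∃ C : ℝ, ∀ M a, |f M a| ≤ C)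
    (η : ℝ) (hη : 0 < η) (T : ℕ)
    -- the algorithm, the beliefs, and the reference probabilities
    (p : (t : ℕ) → Kernel (History A 𝒪 t) A) [∀ t, IsMarkovKernel (p t)]
    (ν : (t : ℕ) → Kernel (History A 𝒪 t) (𝓜 × A)) [∀ t, IsMarkovKernel (ν t)]
    (q : (t : ℕ) → Kernel (History A 𝒪 t) A) [∀ t, IsMarkovKernel (q t)]
    -- the play
    [MeasurableSpace Ω] (P : Measure Ω) [IsProbabilityMeasure P]
    (model : ℕ → Ω → 𝓜) (dec : ℕ → Ω → A) (out : ℕ → Ω → 𝒪)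
    (hplay : IsPlay obs T p P model dec out)
    -- the first reference probability is uniform
    (hq_zero : ∀ h, q 0 h = uniformOn Set.univ)
    -- the next one is (a version of) the posterior of the current belief
    (hq_succ : ∀ t, t + 1 < T → ∀ᵐ ω ∂P, ∀ a, p t (history dec out t ω) {a} ≠ 0 →
      ∀ᵐ o ∂(predictive obs (ν t (history dec out t ω)) a),
        q (t + 1) (Fin.snoc (α := fun _ => A × 𝒪) (history dec out t ω) (a, o))
          = decisionPosterior obs (ν t (history dec out t ω)) a o)
    -- that posterior is determined at the actual observation
    (hac : ∀ t, t + 1 < T → ∀ᵐ ω ∂P, ∀ a, p t (history dec out t ω) {a} ≠ 0 →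
      obs (model t ω, a) ≪ predictive obs (ν t (history dec out t ω)) a)
    -- the reference probabilities lie in the interior of the simplex
    (hq_int : ∀ t < T, ∀ᵐ ω ∂P, ∀ a, q t (history dec out t ω) {a} ≠ 0) :
    ((regret f T P model dec : ℝ) : EReal)
      ≤ ((Real.log (Fintype.card A) / η : ℝ) : EReal)
        + extExpectation P (fun ω => ∑ t ∈ Finset.range T,
            (((AIR obs f η (q t (history dec out t ω)) (p t (history dec out t ω))
                (ν t (history dec out t ω)) : ℝ) : EReal)
              + firstOrderGap obs f η (q t (history dec out t ω)) (p t (history dec out t ω))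
                  (ν t (history dec out t ω)))) := by
  obtain ⟨C, hC⟩ := hfb
  have hcard : (1 : ℝ) ≤ Fintype.card A := by exact_mod_cast Fintype.card_pos (α := A)
  have hmean : ∀ t ω, |∑ a, (p t (history dec out t ω)).real {a} * f (model t ω) a| ≤ C := by
    intro t ω
    calc |∑ a, (p t (history dec out t ω)).real {a} * f (model t ω) a|
        ≤ ∑ a, |(p t (history dec out t ω)).real {a} * f (model t ω) a| :=
          Finset.abs_sum_le_sum_abs _ _
      _ ≤ ∑ a, (p t (history dec out t ω)).real {a} * C := by
          refine Finset.sum_le_sum fun a _ => ?_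
          rw [abs_mul, abs_of_nonneg measureReal_nonneg]
          exact mul_le_mul_of_nonneg_left (hC _ _) measureReal_nonneg
      _ = C := by rw [← Finset.sum_mul, sum_measureReal_singleton_eq_one, one_mul]
  have mmean : ∀ t < T, Measurable fun ω =>
      ∑ a, (p t (history dec out t ω)).real {a} * f (model t ω) a := fun t ht => by
    refine Finset.measurable_sum _ fun a _ => ?_
    exact (((Kernel.measurable_coe (p t) (measurableSet_singleton a)).comp
      (hplay.measurable_history ht.le)).ennreal_toReal).mul
      ((hf a).comp (hplay.measurable_model t ht))
  -- The bound with the next log loss replaced by `v = 0` requires no domination. It serves the last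
  -- round, and also yields the uniform lower bound on the summands.
  have hstep : ∀ b, ∀ t < T, ∀ᵐ ω ∂P,
      ((f (model t ω) b - ∑ a, (p t (history dec out t ω)).real {a} * f (model t ω) a
        - (negLog (q t (history dec out t ω) {b})).toReal / η : ℝ) : EReal)
      ≤ (AIR obs f η (q t (history dec out t ω)) (p t (history dec out t ω))
          (ν t (history dec out t ω)) : EReal)
        + firstOrderGap obs f η (q t (history dec out t ω)) (p t (history dec out t ω))
          (ν t (history dec out t ω)) := by
    intro b t ht
    filter_upwards [hq_int t ht] with ω hω
    have := le_AIR_add_firstOrderGap obs hf hC hη (q t (history dec out t ω))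
      (p t (history dec out t ω)) hω (ν t (history dec out t ω)) (model t ω) b (v := 0) zero_le
    rw [mul_zero, EReal.coe_ennreal_zero, add_zero] at this
    rw [toReal_negLog (hω b)]
    refine le_trans (le_of_eq ?_) this
    congr 1; ring
  have hregret : ∀ b, ∫ ω, (∑ t ∈ Finset.range T, f (model t ω) b
      - ∑ t ∈ Finset.range T, f (model t ω) (dec t ω)) ∂P
      = ∑ t ∈ Finset.range T, ∫ ω, (f (model t ω) b
        - ∑ a, (p t (history dec out t ω)).real {a} * f (model t ω) a) ∂P := by
    intro b
    have i1 : ∀ t < T, Integrable (fun ω => f (model t ω) b) P := fun t ht =>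
      integrable_of_bounded ((hf b).comp (hplay.measurable_model t ht)) C fun ω => hC _ _
    have i2 : ∀ t < T, Integrable (fun ω => f (model t ω) (dec t ω)) P := fun t ht =>
      integrable_of_bounded ((measurable_uncurry_reward hf).comp
        ((hplay.measurable_model t ht).prodMk (hplay.measurable_dec t ht))) C fun ω => hC _ _
    have i3 : ∀ t < T, Integrable (fun ω =>
        ∑ a, (p t (history dec out t ω)).real {a} * f (model t ω) a) P := fun t ht =>
      integrable_of_bounded (mmean t ht) C (hmean t)
    simp only [← Finset.sum_sub_distrib]
    rw [integral_finsetSum]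
    · refine Finset.sum_congr rfl fun t ht => ?_
      have ht := Finset.mem_range.1 ht
      rw [integral_sub (i1 t ht) (i2 t ht), integral_sub (i1 t ht) (i3 t ht),
        hplay.integral_decision ht hf hC]
    · intro t ht
      have ht := Finset.mem_range.1 ht
      exact (i1 t ht).sub (i2 t ht)
  -- The supremum over the finite decision space is attained, so a single comparator may be fixed.
  obtain ⟨b, hb⟩ : ∃ b, regret f T P model dec = ∫ ω, (∑ t ∈ Finset.range T, f (model t ω) b
      - ∑ t ∈ Finset.range T, f (model t ω) (dec t ω)) ∂P := by
    obtain ⟨b, hb⟩ := exists_eq_ciSup_of_finite (f := fun b : A => ∫ ω,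
      (∑ t ∈ Finset.range T, f (model t ω) b
        - ∑ t ∈ Finset.range T, f (model t ω) (dec t ω)) ∂P)
    exact ⟨b, hb.symm⟩
  rw [hb, hregret b]
  have mU : ∀ t, Measurable fun h : History A 𝒪 t => negLog (q t h {b}) := fun t =>
    measurable_negLog.comp (Kernel.measurable_coe _ (measurableSet_singleton b))
  refine sum_integral_le_add_extExpectation (C := C + C)
    (K := C + C + Real.log (Fintype.card A) / η)
    (U := fun t ω => negLog (q t (history dec out t ω) {b}))
    (V := fun t ω => ∫⁻ a, ∫⁻ o, negLog
      (q (t + 1) (Fin.snoc (α := fun _ => A × 𝒪) (history dec out t ω) (a, o)) {b})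
        ∂(obs (model t ω, a)) ∂(p t (history dec out t ω)))
    hη (Real.log_nonneg hcard) ?_ ?_ ?_ ?_ ?_ ?_ ?_ (hstep b) ?_ ?_
  · exact fun t ht => ((hf b).comp (hplay.measurable_model t ht)).sub (mmean t ht)
  · exact fun t ω => (abs_sub _ _).trans (add_le_add (hC _ _) (hmean t ω))
  · exact fun t ht => (mU t).comp (hplay.measurable_history ht.le)
  · exact fun t ht => (hplay.lintegral_history_succ (by omega) (mU (t + 1))).1
  · intro t ht
    filter_upwards [hq_int t ht] with ω hω
    rw [negLog_eq_ofReal (hω b) (measure_ne_top _ _)]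
    exact ENNReal.ofReal_ne_top
  · have : ∀ ω, negLog (q 0 (history dec out 0 ω) {b})
        = ENNReal.ofReal (Real.log (Fintype.card A)) := by
      intro ω
      have e : q 0 (history dec out 0 ω) {b} = (Fintype.card A : ℝ≥0∞)⁻¹ := by
        rw [hq_zero, uniformOn_univ]; simp
      rw [e, negLog_eq_ofReal (by simp) (by simp)]
      simp
    simp [this]
  · exact fun t ht => (hplay.lintegral_history_succ (by omega) (mU (t + 1))).2
  · intro t ht
    filter_upwards [hq_int t (by omega), hac t ht, hq_succ t ht] with ω hω hacω hqω
    have := le_AIR_add_firstOrderGap_of_ac obs hf hC hη (q t (history dec out t ω))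
      (p t (history dec out t ω)) hω (ν t (history dec out t ω)) (model t ω) b hacω
    rw [toReal_negLog (hω b)]
    refine le_trans (le_of_eq ?_) this
    congr 1
    · congr 1; ring
    · congr 2
      refine lintegral_congr_ae (ae_iff_of_countable.2 fun a ha => ?_)
      -- The next reference law equals the posterior only almost everywhere for the predictive law;
      -- domination transfers this to the law of the actual observation.
      refine lintegral_congr_ae ((hacω a ha).ae_le ?_)
      filter_upwards [hqω a ha] with o ho
      rw [ho]
  · intro t ht
    have hall : ∀ᵐ ω ∂P, ∀ b, _ := ae_all_iff.2 fun b => hstep b t ht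
    filter_upwards [hall, hq_int t ht] with ω hω hint
    -- The comparator is free in `hstep`: one of mass at least `1 / |A|` has log loss at most `log
    -- |A|`, whence the constant `K`.
    obtain ⟨b', hb'⟩ := exists_inv_card_le_measureReal (q t (history dec out t ω))
    refine le_trans (EReal.coe_le_coe_iff.2 ?_) (hω b')
    rw [toReal_negLog (hint b')]
    have h1 := Real.log_le_log (by positivity) hb'
    rw [Real.log_inv] at h1
    have h2 := (abs_le.1 (hC (model t ω) b')).1
    have h3 := (abs_le.1 (hmean t ω)).2
    have h4 : -Real.log ((q t (history dec out t ω)).real {b'}) / η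
        ≤ Real.log (Fintype.card A) / η := by
      gcongr; linarith
    linarith
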